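/- Let $\mathcal M$ be a type $\mathrm{II}_1$ factor acting on a Hilbert space, i.e. an infinite-dimensional factor with a (necessarily unique) faithful normal tracial state $\mathrm{tr}$, and put $\|x\|_2=\mathrm{tr}(x^*x)^{1/2}$. For a von Neumann subalgebra $\mathcal N\subseteq\mathcal M$ (containing the unit of $\mathcal M$) let $\mathbb E_{\mathcal N}:\mathcal M\to\mathcal N$ be the unique trace-preserving conditional expectation, and for a linear map $\phi:\mathcal M\to\mathcal M$ let $\|\phi\|_{\infty,2}=\sup\{\|\phi(x)\|_2 : x\in\mathcal M,\ \|x\|\le 1\}$. **Theorem 6.7.** Let $\mathcal A$ be an abelian von Neumann subalgebra of $\mathcal M$. Suppose that $\mathbb E_{\mathcal A}$ is an asymptotic homomorphism, that is, there is a unitary $u\in\mathcal A$ such that $$\lim_{|k|\to\infty}\bigl\|\mathbb E_{\mathcal A}(xu^ky)-\mathbb E_{\mathcal A}(x)\,\mathbb E_{\mathcal A}(y)\,u^k\bigr\|_2=0\qquad (k\in\mathbb Z)$$ for all $x,y\in\mathcal M$. Then: 1. $\mathcal A$ is a masa of $\mathcal M$ (maximal among the abelian self-adjoint subalgebras of $\mathcal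 M$), and it is strongly singular: for every unitary $w\in\mathcal M$, $$\|\mathbb E_{w\mathcal Aw^*}-\mathbb E_{\mathcal A}\|_{\infty,2}\ \ge\ \|w-\mathbb E_{\mathcal A}(w)\|_2 .$$ 2. The Popa invariant of $\mathcal A$ is $\delta(\mathcal A)=1$: the number $1$ is the largest real number $\lambda$ such that $$\sup\{\|x-\mathbb E_{\mathcal A}(x)\|_2 : x\in v\mathcal Av^*,\ \|x\|\le 1\}\ \ge\ \lambda\,\|v^*v\|_2$$ for all non-zero partial isometries $v\in\mathcal M$ for which $vv^*$ and $v^*v$ are orthogonal projections in $\mathcal A$. -/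

import Mathlib

open Filter Topology
open scoped ComplexOrder

namespace MasaTheory

universe v

variable {H : Type v} [NormedAddCommGroup H] [InnerProductSpace ℂ H] [CompleteSpace H]

/-- The underlying complex ⋆-algebra of a von Neumann algebra `M ⊆ B(H)`, as a type. -/
abbrev Elt (M : VonNeumannAlgebra H) : Type v := ↥M.toStarSubalgebra

/-- `M` is commutative. -/
def IsAbelian (M : VonNeumannAlgebra H) : Prop :=
  ∀ x ∈ M, ∀ y ∈ M, x * y = y * x

/-- `M` is a factor: its centre `M ∩ M'` consists of the scalars only. -/
def IsFactor (M : VonNeumannAlgebra H) : Prop :=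
  ∀ z ∈ M, z ∈ M.commutant → ∃ c : ℂ, z = c • (1 : H →L[ℂ] H)

/-- A functional on `M` is normal if it is ultraweakly continuous, that is, of the form
`x ↦ ∑ₙ ⟨ηₙ, x ξₙ⟩` with `∑ₙ ‖ξₙ‖² < ∞` and `∑ₙ ‖ηₙ‖² < ∞`. -/
def IsNormal (M : VonNeumannAlgebra H) (τ : Elt M →ₗ[ℂ] ℂ) : Prop :=
  ∃ ξ η : ℕ → H, Summable (fun n => ‖ξ n‖ ^ 2) ∧ Summable (fun n => ‖η n‖ ^ 2) ∧
    ∀ x : Elt M, HasSum (fun n => inner ℂ (η n) ((x : H →L[ℂ] H) (ξ n))) (τ x)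

/-- `τ` is a faithful normal tracial state on `M` (a normalized trace). -/
structure IsNormalizedTrace (M : VonNeumannAlgebra H) (τ : Elt M →ₗ[ℂ] ℂ) : Prop where
  map_one : τ 1 = 1
  nonneg : ∀ x, 0 ≤ τ (star x * x)
  tracial : ∀ x y, τ (x * y) = τ (y * x)
  faithful : ∀ x, τ (star x * x) = 0 → x = 0
  normal : IsNormal M τ

/-- `M` is a type II₁ factor: an infinite-dimensional factor that has a normalized trace. -/
structure IsTypeII₁Factor (M : VonNeumannAlgebra H) : Prop where
  isFactor : IsFactor M
  infinite_dimensional : ¬ FiniteDimensional ℂ (Elt M)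
  exists_trace : ∃ τ : Elt M →ₗ[ℂ] ℂ, IsNormalizedTrace M τ

open Classical in
/-- The normalized trace of `M` (it is unique on a type II₁ factor). The value is `0` if `M` has
no normalized trace. -/
noncomputable def tr (M : VonNeumannAlgebra H) : Elt M →ₗ[ℂ] ℂ :=
  if h : ∃ τ : Elt M →ₗ[ℂ] ℂ, IsNormalizedTrace M τ then h.choose else 0

/-- `‖x‖₂ = (tr (x* x))^{1/2}`. -/
noncomputable def norm₂ (M : VonNeumannAlgebra H) (x : Elt M) : ℝ :=
  Real.sqrt (tr M (star x * x)).re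

/-- `E : M → M` is a trace-preserving conditional expectation of `M` onto the von Neumann
subalgebra `N`: a positive linear projection onto `N` that is an `N`-bimodule map and preserves
the normalized trace of `M`. -/
structure IsCondExp (M N : VonNeumannAlgebra H) (E : Elt M →ₗ[ℂ] Elt M) : Prop where
  map_mem : ∀ x, (E x : H →L[ℂ] H) ∈ N
  map_of_mem : ∀ x : Elt M, (x : H →L[ℂ] H) ∈ N → E x = x
  positive : ∀ x : Elt M, (x : H →L[ℂ] H).IsPositive → (E x : H →L[ℂ] H).IsPositive
  bimodule : ∀ a b : Elt M, (a : H →L[ℂ] H) ∈ N → (b : H →L[ℂ] H) ∈ N →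
    ∀ x, E (a * x * b) = a * E x * b
  trace_preserving : ∀ x, tr M (E x) = tr M x

open Classical in
/-- The trace-preserving conditional expectation `E_N` of `M` onto `N` (it exists and is unique if
`M` has a normalized trace and `N ≤ M`). The value is `0` if there is none. -/
noncomputable def condExp (M N : VonNeumannAlgebra H) : Elt M →ₗ[ℂ] Elt M :=
  if h : ∃ E : Elt M →ₗ[ℂ] Elt M, IsCondExp M N E then h.choose else 0

/-- `‖φ‖_{∞,2}`: the norm of `φ` as a map from `M` with the operator norm to `M` with `‖·‖₂`. -/
noncomputable def normInftyTwo (M : VonNeumannAlgebra H) (φ : Elt M →ₗ[ℂ] Elt M) : ℝ :=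
  sSup {r : ℝ | ∃ x : Elt M, ‖x‖ ≤ 1 ∧ r = norm₂ M (φ x)}

/-- The von Neumann algebra `u N u* = {u x u* : x ∈ N}` for a unitary `u`. -/
noncomputable def conj (u : unitary (H →L[ℂ] H)) (N : VonNeumannAlgebra H) :
    VonNeumannAlgebra H where
  toStarSubalgebra := N.toStarSubalgebra.map
    (Unitary.conjStarAlgAut ℂ (H →L[ℂ] H) u).toStarAlgHom
  centralizer_centralizer' := by
    have key : ∀ (φ : (H →L[ℂ] H) ≃⋆ₐ[ℂ] (H →L[ℂ] H)) (S : Set (H →L[ℂ] H)),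
        Set.centralizer (φ '' S) = φ '' Set.centralizer S := by
      intro φ S
      ext x
      constructor
      · intro hx
        refine ⟨φ.symm x, ?_, φ.apply_symm_apply x⟩
        intro s hs
        have h := congrArg φ.symm (hx (φ s) ⟨s, hs, rfl⟩)
        rwa [map_mul, map_mul, φ.symm_apply_apply] at h
      · rintro ⟨y, hy, rfl⟩ _ ⟨s, hs, rfl⟩
        rw [← map_mul, ← map_mul, hy s hs]
    change Set.centralizer (Set.centralizer
      ((Unitary.conjStarAlgAut ℂ (H →L[ℂ] H) u) '' (N : Set (H →L[ℂ] H)))) =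
      (Unitary.conjStarAlgAut ℂ (H →L[ℂ] H) u) '' (N : Set (H →L[ℂ] H))
    rw [key, key, N.centralizer_centralizer]

/-- `E_A` is an asymptotic homomorphism: for some unitary `u ∈ A`,
`‖E_A(x uᵏ y) - E_A(x) E_A(y) uᵏ‖₂ → 0` as `|k| → ∞` in `ℤ` (which is convergence along the
cofinite filter of `ℤ`), for all `x, y ∈ M`. -/
def IsAsymptoticHom (M A : VonNeumannAlgebra H) : Prop :=
  ∃ u : unitary (Elt M), ((u : Elt M) : H →L[ℂ] H) ∈ A ∧
    ∀ x y : Elt M,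
      Tendsto (fun k : ℤ => norm₂ M
        (condExp M A (x * ((u ^ k : unitary (Elt M)) : Elt M) * y)
          - condExp M A x * condExp M A y * ((u ^ k : unitary (Elt M)) : Elt M)))
        cofinite (𝓝 0)

/-- `A` is a masa of `M`: a maximal element among the abelian self-adjoint subalgebras of `M`. -/
def IsMasa (M A : VonNeumannAlgebra H) : Prop :=
  Maximal (fun B : StarSubalgebra ℂ (H →L[ℂ] H) =>
    B ≤ M.toStarSubalgebra ∧ ∀ x ∈ B, ∀ y ∈ B, x * y = y * x) A.toStarSubalgebra

/-- `A` is a strongly singular masa of `M`: a masa such that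
`‖E_{uAu*} - E_A‖_{∞,2} ≥ ‖u - E_A(u)‖₂` for all unitaries `u ∈ M`. -/
def IsStronglySingularMasa (M A : VonNeumannAlgebra H) : Prop :=
  IsMasa M A ∧
    ∀ (u : unitary (H →L[ℂ] H)) (hu : (u : H →L[ℂ] H) ∈ M.toStarSubalgebra),
      norm₂ M ((⟨u, hu⟩ : Elt M) - condExp M A ⟨u, hu⟩) ≤
        normInftyTwo M (condExp M (conj u A) - condExp M A)

/-- `v ∈ M` is a non-zero partial isometry such that `v v*` and `v* v` are orthogonal projections
in `A`. -/
structure IsOrthogonalPartialIsometry (M A : VonNeumannAlgebra H) (v : Elt M) : Prop where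
  ne_zero : v ≠ 0
  partial_isometry : v * star v * v = v
  final_mem : ((v * star v : Elt M) : H →L[ℂ] H) ∈ A
  initial_mem : ((star v * v : Elt M) : H →L[ℂ] H) ∈ A
  orthogonal : (v * star v) * (star v * v) = 0

/-- `δ(vAv*, A) = sup {‖x - E_A(x)‖₂ : x ∈ vAv*, ‖x‖ ≤ 1}`. -/
noncomputable def deltaConj (M A : VonNeumannAlgebra H) (v : Elt M) : ℝ :=
  sSup {r : ℝ | ∃ a : Elt M, (a : H →L[ℂ] H) ∈ A ∧ ‖v * a * star v‖ ≤ 1 ∧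
    r = norm₂ M (v * a * star v - condExp M A (v * a * star v))}

/-- The Popa invariant `δ(A)` equals `d`: `d` is the largest real number `l` such that
`δ(vAv*, A) ≥ l ‖v* v‖₂` for all non-zero partial isometries `v ∈ M` whose initial and final
projections are orthogonal projections in `A`. -/
def HasPopaInvariant (M A : VonNeumannAlgebra H) (d : ℝ) : Prop :=
  IsGreatest {l : ℝ | ∀ v : Elt M, IsOrthogonalPartialIsometry M A v →
    l * norm₂ M (star v * v) ≤ deltaConj M A v} d

end MasaTheory

namespace MasaTheory

universe v

variable {H : Type v} [NormedAddCommGroup H] [InnerProductSpace ℂ H]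

/-! Write E for the trace-preserving expectation onto A. Two facts drive the proof: Pythagoras,
‖x‖₂² = ‖E x‖₂² + ‖x − E x‖₂² (`IsCondExp.norm₂_sq_eq`), and ‖E(x uᵏ y)‖₂ → ‖E(x)E(y)‖₂ as |k| → ∞
(`IsAsymptoticUnitary.tendsto_norm₂`).

If x commutes with A, then E(x uᵏ x*) = E(x x*)uᵏ, so the asymptotic relation becomes the exact
identity E(x x*) = E(x)E(x*); its trace and Pythagoras put x in A. For a unitary w, the element w uᵏ
w* of wAw* has squared distance 1 − ‖E(w uᵏ w*)‖₂² from A, which tends to 1 − ‖E(w)E(w*)‖₂² ≥ 1 − ‖E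
w‖₂² = ‖w − E w‖₂². For v as in the Popa invariant, E v = 0, so E(v uᵏ v*) → 0 in ‖·‖₂ while ‖v uᵏ
v*‖₂ = ‖v*v‖₂, and ‖v*v‖₂ also bounds the supremum from above.

The number 1 is the largest constant only if such a v exists. If a self-adjoint c ≠ 0 in A had Ac =
ℂc, the relation would force xc = E(x)c ∈ ℂc for every x ∈ M, and the factor M would be
one-dimensional. Without such c, an extreme point of {a ∈ A : 0 ≤ a ≤ 1, tr a = 1/2} is a projection
e (`IsTraceOn.exists_projection_half`), and e and 1 − e, having equal trace, are equivalent in M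
(`IsTraceOn.exists_partialIsometry`).

The expectation is constructed from the trace: the order interval of N is convex and WOT-compact, so
separation and the finite intersection property yield y ∈ N with tr(yz) = tr(xz) for all z ∈ N
(`IsTraceOn.exists_condExp_Icc`). -/

/-! ### Compactness and closedness in the weak operator topology -/

theorem continuous_wot_mul_left (a : H →L[ℂ] H) :
    Continuous fun x : H →WOT[ℂ] H => ContinuousLinearMapWOT.ofCLM (a * x.toCLM) :=
  continuous_const_mul (ContinuousLinearMapWOT.ofCLM a)

theorem continuous_wot_mul_right (a : H →L[ℂ] H) :
    Continuous fun x : H →WOT[ℂ] H => ContinuousLinearMapWOT.ofCLM (x.toCLM * a) :=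
  continuous_mul_const (ContinuousLinearMapWOT.ofCLM a)

theorem isClosed_wot_eq {f g : (H →WOT[ℂ] H) → (H →L[ℂ] H)}
    (hf : Continuous fun x => ContinuousLinearMapWOT.ofCLM (f x))
    (hg : Continuous fun x => ContinuousLinearMapWOT.ofCLM (g x)) :
    IsClosed {x | f x = g x} := by
  have := isClosed_eq hf hg
  convert this using 3
  exact (ContinuousLinearMapWOT.ofCLM_injective.eq_iff).symm

variable [CompleteSpace H]

/-- A form obtained as a pointwise limit of `⟪T v, w⟫` along an ultrafilter of contractions. -/
theorem exists_contraction_of_ultrafilter (f : Ultrafilter (H →WOT[ℂ] H))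
    (hf : {T : H →WOT[ℂ] H | ‖T.toCLM‖ ≤ 1} ∈ f) :
    ∃ S : H →L[ℂ] H, ‖S‖ ≤ 1 ∧
      ∀ v w, Tendsto (fun T : H →WOT[ℂ] H => inner ℂ (T v) w) f (𝓝 (inner ℂ (S v) w)) := by
  have hlim : ∀ v w : H, ∃ z : ℂ, ‖z‖ ≤ ‖v‖ * ‖w‖ ∧
      Tendsto (fun T : H →WOT[ℂ] H => inner ℂ (T v) w) f (𝓝 z) := by
    intro v w
    have hK := isCompact_closedBall (0 : ℂ) (‖v‖ * ‖w‖)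
    rw [isCompact_iff_ultrafilter_le_nhds'] at hK
    obtain ⟨z, hz, hz'⟩ := hK (f.map fun T : H →WOT[ℂ] H => inner ℂ (T v) w) (by
      rw [Ultrafilter.mem_map]
      filter_upwards [hf] with T hT
      simp only [Set.mem_preimage, mem_closedBall_zero_iff]
      refine (norm_inner_le_norm _ _).trans ?_
      have := T.toCLM.le_of_opNorm_le hT v
      rw [one_mul] at this
      exact mul_le_mul_of_nonneg_right this (norm_nonneg _))
    exact ⟨z, by simpa using hz, hz'⟩
  choose B hB hBt using hlim
  have key : ∀ {v w : H} {z : ℂ},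
      Tendsto (fun T : H →WOT[ℂ] H => inner ℂ (T v) w) f (𝓝 z) → B v w = z :=
    fun h => tendsto_nhds_unique (hBt _ _) h
  let L : H →ₗ⋆[ℂ] H →ₗ[ℂ] ℂ := LinearMap.mk₂'ₛₗ (starRingEnd ℂ) (RingHom.id ℂ) B
    (fun v v' w => key (by simpa [inner_add_left] using (hBt v w).add (hBt v' w)))
    (fun c v w => key (by
      simpa [inner_smul_left, mul_comm] using (hBt v w).const_mul (starRingEnd ℂ c)))
    (fun v w w' => key (by simpa [inner_add_right] using (hBt v w).add (hBt v w')))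
    (fun c v w => key (by simpa [inner_smul_right] using (hBt v w).const_mul c))
  let L' := L.mkContinuous₂ 1 (fun v w => by simpa [L] using hB v w)
  have hS : ∀ v w, inner ℂ (InnerProductSpace.continuousLinearMapOfBilin L' v) w = B v w :=
    fun v w => InnerProductSpace.continuousLinearMapOfBilin_apply L' v w
  refine ⟨InnerProductSpace.continuousLinearMapOfBilin L', ?_, fun v w => ?_⟩
  · refine ContinuousLinearMap.opNorm_le_bound _ zero_le_one fun v => ?_
    have h := hB v (InnerProductSpace.continuousLinearMapOfBilin L' v)
    rw [← hS, inner_self_eq_norm_sq_to_K] at h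
    simp only [sq, norm_mul, RCLike.norm_ofReal, abs_norm] at h
    by_cases h0 : ‖InnerProductSpace.continuousLinearMapOfBilin L' v‖ = 0
    · rw [h0]; positivity
    · rw [one_mul]
      exact le_of_mul_le_mul_right h (lt_of_le_of_ne (norm_nonneg _) (Ne.symm h0))
  · rw [hS]; exact hBt v w

/-- The closed unit ball of `B(H)` is compact in the weak operator topology. -/
theorem isCompact_unitBall_wot : IsCompact {T : H →WOT[ℂ] H | ‖T.toCLM‖ ≤ 1} := by
  rw [isCompact_iff_ultrafilter_le_nhds']
  intro f hf
  obtain ⟨S, hS, hS'⟩ := exists_contraction_of_ultrafilter f hf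
  refine ⟨.ofCLM S, hS, ?_⟩
  rw [ContinuousLinearMapWOT.le_nhds_iff_forall_inner_apply_le_nhds]
  intro v w
  -- The form was built from ⟪T v, w⟫, whereas the topology tests ⟪w, T v⟫.
  have := (Complex.continuous_conj.tendsto _).comp (hS' v w)
  simpa [Function.comp_def, Tendsto] using this

/-- A von Neumann algebra is closed in the weak operator topology. -/
theorem isClosed_wot_mem (M : VonNeumannAlgebra H) :
    IsClosed {x : H →WOT[ℂ] H | x.toCLM ∈ M} := by
  have : {x : H →WOT[ℂ] H | x.toCLM ∈ M} =
      ⋂ y : M.commutant, {x : H →WOT[ℂ] H | (y : H →L[ℂ] H) * x.toCLM = x.toCLM * y} := by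
    ext x
    have h := VonNeumannAlgebra.mem_commutant_iff (S := M.commutant) (z := x.toCLM)
    rw [VonNeumannAlgebra.commutant_commutant] at h
    simpa using h
  rw [this]
  exact isClosed_iInter fun y => isClosed_wot_eq (continuous_wot_mul_left _)
    (continuous_wot_mul_right _)

theorem isClosed_wot_nonneg : IsClosed {x : H →WOT[ℂ] H | 0 ≤ x.toCLM} := by
  have : {x : H →WOT[ℂ] H | 0 ≤ x.toCLM} = ⋂ v : H, {x : H →WOT[ℂ] H |
      star (inner ℂ v (x v)) = inner ℂ v (x v) ∧ 0 ≤ (inner ℂ v (x v)).re} := by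
    ext x
    simp only [Set.mem_ofPred_eq, Set.mem_iInter, ContinuousLinearMap.nonneg_iff_isPositive,
      ContinuousLinearMap.isPositive_iff_complex]
    refine forall_congr' fun v => ?_
    rw [ContinuousLinearMapWOT.toCLM_apply, ← inner_conj_symm (x v) v]
    simp only [RCLike.re_to_complex, Complex.conj_re]
    constructor
    · rintro ⟨h1, h2⟩
      refine ⟨?_, h2⟩
      have := congrArg (starRingEnd ℂ) h1
      rw [Complex.conj_conj, Complex.conj_ofReal] at this
      rw [Complex.star_def, ← h1, this]
    · rintro ⟨h1, h2⟩
      refine ⟨?_, h2⟩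
      rw [Complex.star_def] at h1
      rw [h1]
      exact Complex.conj_eq_iff_re.1 h1
  rw [this]
  refine isClosed_iInter fun v => ?_
  have hc : Continuous fun x : H →WOT[ℂ] H => inner ℂ v (x v) :=
    ContinuousLinearMapWOT.continuous_iff.1 continuous_id v v
  exact (isClosed_eq (continuous_star.comp hc) hc).inter
    (isClosed_le continuous_const (Complex.continuous_re.comp hc))

/-! ### Traces as functionals on B(H) -/

/-- A linear functional on `B(H)` that restricts to a faithful tracial state on `M` and is
continuous in the weak operator topology on balls. -/
structure IsTraceOn (M : VonNeumannAlgebra H) (T : (H →L[ℂ] H) →ₗ[ℂ] ℂ) : Prop where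
  map_one : T 1 = 1
  nonneg : ∀ x ∈ M, 0 ≤ T (star x * x)
  tracial : ∀ x ∈ M, ∀ y ∈ M, T (x * y) = T (y * x)
  faithful : ∀ x ∈ M, T (star x * x) = 0 → x = 0
  continuousOn : ∀ r, ContinuousOn (fun x : H →WOT[ℂ] H => T x.toCLM) {x | ‖x.toCLM‖ ≤ r}

/-- The series from normality makes sense on all of B(H). On the ball of radius r its terms are
dominated by r‖ηₙ‖‖ξₙ‖, so it converges uniformly there and WOT-continuity passes to the sum. -/
theorem IsNormalizedTrace.exists_isTraceOn {M : VonNeumannAlgebra H} {τ : Elt M →ₗ[ℂ] ℂ}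
    (h : IsNormalizedTrace M τ) :
    ∃ T : (H →L[ℂ] H) →ₗ[ℂ] ℂ, IsTraceOn M T ∧ ∀ x : Elt M, T x = τ x := by
  obtain ⟨ξ, η, hξ, hη, hτ⟩ := h.normal
  have hs : Summable fun n => ‖η n‖ * ‖ξ n‖ := by
    refine Summable.of_nonneg_of_le (fun n => by positivity) (fun n => ?_) (hη.add hξ)
    nlinarith [sq_nonneg (‖η n‖ - ‖ξ n‖), sq_nonneg ‖η n‖, sq_nonneg ‖ξ n‖]
  have hbd : ∀ (x : H →L[ℂ] H) n,
      ‖(inner ℂ (η n) (x (ξ n)) : ℂ)‖ ≤ ‖x‖ * (‖η n‖ * ‖ξ n‖) := by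
    intro x n
    calc ‖(inner ℂ (η n) (x (ξ n)) : ℂ)‖ ≤ ‖η n‖ * (‖x‖ * ‖ξ n‖) :=
          (norm_inner_le_norm _ _).trans
            (mul_le_mul_of_nonneg_left (x.le_opNorm _) (norm_nonneg _))
      _ = _ := by ring
  have hsum : ∀ x : H →L[ℂ] H, Summable fun n => (inner ℂ (η n) (x (ξ n)) : ℂ) := fun x =>
    Summable.of_norm_bounded (hs.mul_left ‖x‖) (hbd x)
  let T : (H →L[ℂ] H) →ₗ[ℂ] ℂ :=
    { toFun := fun x => ∑' n, inner ℂ (η n) (x (ξ n))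
      map_add' := fun x y => by
        simp only [add_apply, inner_add_right]
        exact (hsum x).tsum_add (hsum y)
      map_smul' := fun c x => by
        simp only [smul_apply, inner_smul_right, RingHom.id_apply, smul_eq_mul]
        exact tsum_mul_left }
  have hT : ∀ x : Elt M, T x = τ x := fun x => (hτ x).tsum_eq
  refine ⟨T, ⟨?_, ?_, ?_, ?_, ?_⟩, hT⟩
  · have := hT 1
    rwa [h.map_one] at this
  · intro x hx
    have := h.nonneg ⟨x, hx⟩
    rwa [← hT] at this
  · intro x hx y hy
    have := h.tracial ⟨x, hx⟩ ⟨y, hy⟩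
    rwa [← hT, ← hT] at this
  · intro x hx h0
    have := h.faithful ⟨x, hx⟩ (by rw [← hT]; exact h0)
    exact congrArg Subtype.val this
  · intro r
    refine continuousOn_tsum (u := fun n => r * (‖η n‖ * ‖ξ n‖)) (fun n => ?_) (hs.mul_left r) ?_
    · exact (ContinuousLinearMapWOT.continuous_iff.1 continuous_id (ξ n) (η n)).continuousOn
    · intro n x hx
      exact (hbd x.toCLM n).trans
        (mul_le_mul_of_nonneg_right hx (by positivity))

theorem smul_mem (M : VonNeumannAlgebra H) (c : ℂ) {x : H →L[ℂ] H} (hx : x ∈ M) : c • x ∈ M :=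
  M.toStarSubalgebra.smul_mem hx c

theorem real_smul_mem (M : VonNeumannAlgebra H) (c : ℝ) {x : H →L[ℂ] H} (hx : x ∈ M) :
    c • x ∈ M := by
  have := smul_mem M (c : ℂ) hx
  rwa [Complex.coe_smul] at this

theorem mem_iff_commute (M : VonNeumannAlgebra H) {x : H →L[ℂ] H} :
    x ∈ M ↔ ∀ y ∈ M.commutant, y * x = x * y := by
  have h := VonNeumannAlgebra.mem_commutant_iff (S := M.commutant) (z := x)
  rwa [VonNeumannAlgebra.commutant_commutant] at h

/-- Bicommutant: whatever commutes with the self-adjoint algebra's commutant passes to the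
functional calculus, since `cfc f x` commutes with everything that x commutes with. -/
theorem cfc_mem (M : VonNeumannAlgebra H) (f : ℝ → ℝ) {x : H →L[ℂ] H} (hx : x ∈ M) :
    cfc f x ∈ M := by
  rw [mem_iff_commute] at hx ⊢
  intro y hy
  exact ((Commute.cfc_real (show Commute x y from (hx y hy).symm) f).eq).symm

theorem exists_mul_self_eq (M : VonNeumannAlgebra H) {b : H →L[ℂ] H} (hb : b ∈ M) (h0 : 0 ≤ b) :
    ∃ s ∈ M, star s = s ∧ s * s = b := by
  have hsa : IsSelfAdjoint b := .of_nonneg h0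
  refine ⟨cfc Real.sqrt b, cfc_mem M _ hb,
    (cfc_predicate Real.sqrt b : IsSelfAdjoint _).star_eq, ?_⟩
  rw [← cfc_mul Real.sqrt Real.sqrt b]
  conv_rhs => rw [← cfc_id ℝ b]
  refine cfc_congr fun t ht => ?_
  exact Real.mul_self_sqrt (spectrum_nonneg_of_nonneg h0 ht)

section IsTraceOn

variable {M : VonNeumannAlgebra H} {T : (H →L[ℂ] H) →ₗ[ℂ] ℂ}

theorem IsTraceOn.map_nonneg (hT : IsTraceOn M T) {b : H →L[ℂ] H} (hb : b ∈ M) (h0 : 0 ≤ b) :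
    0 ≤ T b := by
  obtain ⟨s, hs, hs1, rfl⟩ := exists_mul_self_eq M hb h0
  simpa [hs1] using hT.nonneg s hs

theorem IsTraceOn.eq_zero_of_nonneg (hT : IsTraceOn M T) {b : H →L[ℂ] H} (hb : b ∈ M)
    (h0 : 0 ≤ b) (h : T b = 0) : b = 0 := by
  obtain ⟨s, hs, hs1, rfl⟩ := exists_mul_self_eq M hb h0
  rw [hT.faithful s hs (by rwa [hs1]), mul_zero]

theorem IsTraceOn.mul_nonneg (hT : IsTraceOn M T) {a b : H →L[ℂ] H} (ha : a ∈ M) (hb : b ∈ M)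
    (ha0 : 0 ≤ a) (hb0 : 0 ≤ b) : 0 ≤ T (a * b) := by
  obtain ⟨s, hs, hs1, rfl⟩ := exists_mul_self_eq M hb hb0
  rw [← mul_assoc, hT.tracial _ (mul_mem ha hs) _ hs, ← mul_assoc]
  have : 0 ≤ star s * a * s := star_left_conjugate_nonneg ha0 s
  rw [hs1] at this
  exact hT.map_nonneg (mul_mem (mul_mem hs ha) hs) this

/-- Positivity at b + 1 and at b makes T(b) + T(b*) real; b = a and b = ia then give both parts of
the identity. -/
theorem IsTraceOn.map_star (hT : IsTraceOn M T) {a : H →L[ℂ] H} (ha : a ∈ M) :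
    T (star a) = star (T a) := by
  have key : ∀ b ∈ M, (T b + T (star b)).im = 0 := by
    intro b hb
    have h1 := hT.nonneg (b + 1) (add_mem hb (one_mem M))
    have h2 := hT.nonneg b hb
    have : star (b + 1) * (b + 1) = star b * b + (b + star b) + 1 := by
      rw [star_add, star_one]; noncomm_ring
    rw [this, _root_.map_add, _root_.map_add, _root_.map_add, hT.map_one] at h1
    have h1' := (Complex.le_def.1 h1).2
    have h2' := (Complex.le_def.1 h2).2
    simp only [Complex.add_im, Complex.zero_im, Complex.one_im] at h1' h2' ⊢
    linarith
  have h1 := key a ha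
  have h2 := key (Complex.I • a) (smul_mem M _ ha)
  rw [star_smul, map_smul, map_smul] at h2
  simp only [smul_eq_mul, Complex.star_def, Complex.conj_I, Complex.add_im, Complex.mul_im,
    Complex.I_re, Complex.I_im, Complex.neg_re, Complex.neg_im] at h1 h2
  apply Complex.ext <;> simp only [Complex.star_def, Complex.conj_re, Complex.conj_im] <;> linarith

/-! ### Construction of the conditional expectation -/

theorem isCompact_wot_Icc (N : VonNeumannAlgebra H) :
    IsCompact {y : H →WOT[ℂ] H | y.toCLM ∈ N ∧ 0 ≤ y.toCLM ∧ y.toCLM ≤ 1} := by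
  have : {y : H →WOT[ℂ] H | y.toCLM ∈ N ∧ 0 ≤ y.toCLM ∧ y.toCLM ≤ 1} =
      {y | ‖y.toCLM‖ ≤ 1} ∩ ({y | y.toCLM ∈ N} ∩ {y | 0 ≤ y.toCLM}) := by
    ext y
    simp only [Set.mem_inter_iff, Set.mem_ofPred_eq]
    constructor
    · rintro ⟨h1, h2, h3⟩
      exact ⟨(CStarAlgebra.norm_le_one_iff_of_nonneg _ h2).2 h3, h1, h2⟩
    · rintro ⟨h3, h1, h2⟩
      exact ⟨h1, h2, (CStarAlgebra.norm_le_one_iff_of_nonneg _ h2).1 h3⟩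
  rw [this]
  exact isCompact_unitBall_wot.inter_right ((isClosed_wot_mem N).inter isClosed_wot_nonneg)

theorem convex_wot_Icc (N : VonNeumannAlgebra H) :
    Convex ℝ {y : H →WOT[ℂ] H | y.toCLM ∈ N ∧ 0 ≤ y.toCLM ∧ y.toCLM ≤ 1} := by
  rintro x ⟨hx, hx0, hx1⟩ y ⟨hy, hy0, hy1⟩ a b ha hb hab
  refine ⟨add_mem (real_smul_mem N a hx) (real_smul_mem N b hy), ?_, ?_⟩
  · exact add_nonneg (smul_nonneg ha hx0) (smul_nonneg hb hy0)
  · calc a • x.toCLM + b • y.toCLM ≤ a • (1 : H →L[ℂ] H) + b • (1 : H →L[ℂ] H) :=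
        add_le_add (smul_le_smul_of_nonneg_left hx1 ha) (smul_le_smul_of_nonneg_left hy1 hb)
      _ = 1 := by rw [← add_smul, hab, one_smul]

theorem IsTraceOn.continuousOn_mul_right (hT : IsTraceOn M T) (z : H →L[ℂ] H) :
    ContinuousOn (fun y : H →WOT[ℂ] H => T (y.toCLM * z)) {y | ‖y.toCLM‖ ≤ 1} := by
  refine (hT.continuousOn ‖z‖).comp (continuous_wot_mul_right z).continuousOn ?_
  intro y hy
  refine (norm_mul_le _ _).trans ?_
  simpa using mul_le_mul_of_nonneg_right hy (norm_nonneg z)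

/-- `T (x z)` is at most `T (z⁺)`, which is almost attained on the order interval of `N`. -/
theorem IsTraceOn.exists_re_le (hT : IsTraceOn M T) {N : VonNeumannAlgebra H} (hNM : N ≤ M)
    {x : H →L[ℂ] H} (hx : x ∈ M) (hx0 : 0 ≤ x) (hx1 : x ≤ 1) {z : H →L[ℂ] H} (hz : z ∈ N)
    (hzsa : IsSelfAdjoint z) {ε : ℝ} (hε : 0 < ε) :
    ∃ y ∈ N, 0 ≤ y ∧ y ≤ 1 ∧ (T (x * z)).re ≤ (T (y * z)).re + ε := by
  -- Here g(t) = t⁺, and f is a continuous substitute for the indicator of t > 0, with t f(t) ≥ g(t)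
  -- − ε. The estimate is the chain T(xz) ≤ T(x g(z)) ≤ T(g(z)) ≤ T(f(z)z) + ε.
  let g : ℝ → ℝ := fun t => max t 0
  let f : ℝ → ℝ := fun t => max t 0 / (max t 0 + ε)
  have hpos : ∀ t : ℝ, 0 < max t 0 + ε := fun t => by positivity
  have hg : Continuous g := by fun_prop
  have hf : Continuous f := Continuous.div (by fun_prop) (by fun_prop) fun t => (hpos t).ne'
  have hgN : cfc g z ∈ N := cfc_mem N g hz
  have hg0 : 0 ≤ cfc g z := cfc_nonneg fun t _ => le_max_right _ _
  refine ⟨cfc f z, cfc_mem N f hz, cfc_nonneg fun t _ => ?_, cfc_le_one f z fun t _ => ?_, ?_⟩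
  · exact div_nonneg (le_max_right _ _) (hpos t).le
  · rw [div_le_one (hpos t)]; linarith
  · have h1 : 0 ≤ T (x * (cfc g z - z)) := by
      refine hT.mul_nonneg hx (sub_mem (hNM hgN) (hNM hz)) hx0 (sub_nonneg.2 ?_)
      conv_lhs => rw [← cfc_id ℝ z]
      exact cfc_mono (fun t _ => le_max_left _ _) continuousOn_id hg.continuousOn
    have h2 : 0 ≤ T ((1 - x) * cfc g z) :=
      hT.mul_nonneg (sub_mem (one_mem M) hx) (hNM hgN) (sub_nonneg.2 hx1) hg0
    have h3 : 0 ≤ T (cfc f z * z + ε • 1 - cfc g z) := by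
      refine hT.map_nonneg (sub_mem (add_mem (hNM (mul_mem (cfc_mem N f hz) hz))
        (real_smul_mem M _ (one_mem M))) (hNM hgN)) (sub_nonneg.2 ?_)
      have : cfc f z * z + ε • 1 = cfc (fun t => f t * t + ε) z := by
        rw [cfc_add_const ε (fun t => f t * t) z (by fun_prop), cfc_mul f (fun t => t) z
          hf.continuousOn continuousOn_id, cfc_id' ℝ z, Algebra.algebraMap_eq_smul_one]
      rw [this]
      refine cfc_mono (fun t _ => ?_) hg.continuousOn (by fun_prop)
      simp only [f, g]
      rw [div_mul_eq_mul_div, div_add' _ _ _ (hpos t).ne', le_div_iff₀ (hpos t)]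
      rcases le_total t 0 with h | h
      · rw [max_eq_right h]; nlinarith
      · rw [max_eq_left h]; nlinarith
    rw [mul_sub, map_sub] at h1
    rw [sub_mul, one_mul, map_sub] at h2
    rw [map_sub, _root_.map_add, ← Complex.coe_smul, map_smul, hT.map_one] at h3
    have h1' := (Complex.le_def.1 h1).1
    have h2' := (Complex.le_def.1 h2).1
    have h3' := (Complex.le_def.1 h3).1
    simp at h1' h2' h3'
    linarith

end IsTraceOn

section IsTraceOn

variable {M : VonNeumannAlgebra H} {T : (H →L[ℂ] H) →ₗ[ℂ] ℂ}

/-- Reduces arbitrary test elements to the self-adjoint ones that `IsTraceOn.exists_re_le` requires.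
-/
theorem IsTraceOn.re_mul_realPart (hT : IsTraceOn M T) {x z : H →L[ℂ] H} (hx : x ∈ M)
    (hxsa : IsSelfAdjoint x) (hz : z ∈ M) :
    (T (x * ((2⁻¹ : ℝ) • (z + star z)))).re = (T (x * z)).re := by
  have h : T (x * star z) = star (T (x * z)) := by
    rw [← hT.map_star (mul_mem hx hz), star_mul, hxsa.star_eq, hT.tracial _ hx _ (star_mem hz)]
  rw [mul_smul_comm, mul_add, ← Complex.coe_smul, map_smul, _root_.map_add, h]
  simp
  ring

/-- A point of `ℝⁿ` on which no linear functional exceeds its supremum over a compact convex set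
belongs to that set. -/
theorem mem_of_forall_sum_le {ι : Type*} [Fintype ι] {K : Set (ι → ℝ)} (hK : IsCompact K)
    (hKc : Convex ℝ K) {p : ι → ℝ}
    (h : ∀ c : ι → ℝ, ∀ ε > 0, ∃ k ∈ K, ∑ i, c i * p i ≤ ∑ i, c i * k i + ε) : p ∈ K := by
  classical
  by_contra hp
  obtain ⟨f, u, hfu, huf⟩ := geometric_hahn_banach_closed_point hKc hK.isClosed hp
  have hf : ∀ q, f q = ∑ i, f (fun w => if i = w then 1 else 0) * q i := fun q => by
    have h := LinearMap.pi_apply_eq_sum_univ (f : (ι → ℝ) →ₗ[ℝ] ℝ) q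
    simp only [ContinuousLinearMap.coe_coe, smul_eq_mul] at h
    rw [h]
    exact Finset.sum_congr rfl fun z _ => mul_comm _ _
  -- The separation gap f(p) − u serves as ε; it would give f(k) ≥ u for some k ∈ K.
  obtain ⟨k, hk, hle⟩ := h (fun i => f (fun w => if i = w then 1 else 0)) _ (sub_pos.2 huf)
  rw [← hf, ← hf] at hle
  have := hfu k hk
  linarith

/-- The real linear map `y ↦ (re T(y z))_z`. -/
noncomputable def rePairing (T : (H →L[ℂ] H) →ₗ[ℂ] ℂ) {ι : Type*} (z : ι → H →L[ℂ] H) :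
    (H →WOT[ℂ] H) →ₗ[ℝ] (ι → ℝ) where
  toFun y i := (T (y.toCLM * z i)).re
  map_add' y y' := by ext i; simp [add_mul]
  map_smul' c y := by
    ext i
    change (T ((c • y.toCLM) * z i)).re = c * _
    rw [smul_mul_assoc, ← Complex.coe_smul, map_smul]
    simp

/-- A linear functional of the vector of pairings is the pairing with the single element z₁ = ∑ c_z
z, so `IsTraceOn.exists_re_le` supplies exactly the hypothesis of `mem_of_forall_sum_le`. -/
theorem IsTraceOn.exists_finset_eq (hT : IsTraceOn M T) {N : VonNeumannAlgebra H} (hNM : N ≤ M)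
    {x : H →L[ℂ] H} (hx : x ∈ M) (hx0 : 0 ≤ x) (hx1 : x ≤ 1) (F : Finset N) :
    ∃ y ∈ N, 0 ≤ y ∧ y ≤ 1 ∧ ∀ z ∈ F, (T (y * z)).re = (T (x * z)).re := by
  let Φ := rePairing T (fun z : F => ((z : N) : H →L[ℂ] H))
  have hΦ : ContinuousOn Φ {y : H →WOT[ℂ] H | y.toCLM ∈ N ∧ 0 ≤ y.toCLM ∧ y.toCLM ≤ 1} := by
    refine continuousOn_pi.2 fun z => Complex.continuous_re.comp_continuousOn
      ((hT.continuousOn_mul_right (z : H →L[ℂ] H)).mono ?_)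
    rintro y ⟨-, h0, h1⟩
    exact (CStarAlgebra.norm_le_one_iff_of_nonneg _ h0).2 h1
  obtain ⟨y, ⟨h1, h2, h3⟩, hy⟩ := mem_of_forall_sum_le
    ((isCompact_wot_Icc N).image_of_continuousOn hΦ) ((convex_wot_Icc N).linear_image Φ)
    (p := fun z : F => (T (x * z)).re) (by
      intro c ε hε
      let z₁ : H →L[ℂ] H := ∑ z : F, c z • (z : H →L[ℂ] H)
      have hz₁ : z₁ ∈ N := sum_mem fun z _ => real_smul_mem N _ (z : N).2
      have hf : ∀ y : H →L[ℂ] H, ∑ z : F, c z * (T (y * z)).re = (T (y * z₁)).re := by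
        intro y
        simp only [z₁, Finset.mul_sum, map_sum, Complex.re_sum, mul_smul_comm,
          ← Complex.coe_smul, map_smul, smul_eq_mul, Complex.re_ofReal_mul]
      have hsum : z₁ + star z₁ ∈ N := add_mem hz₁ (star_mem hz₁)
      obtain ⟨y, hy, hy0, hy1, hle⟩ := hT.exists_re_le hNM hx hx0 hx1
        (z := (2⁻¹ : ℝ) • (z₁ + star z₁)) (real_smul_mem N _ hsum)
        ((IsSelfAdjoint.all (2⁻¹ : ℝ)).smul (IsSelfAdjoint.add_star_self z₁)) hε
      rw [hT.re_mul_realPart hx (.of_nonneg hx0) (hNM hz₁),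
        hT.re_mul_realPart (hNM hy) (.of_nonneg hy0) (hNM hz₁), ← hf, ← hf] at hle
      exact ⟨_, ⟨.ofCLM y, ⟨hy, hy0, hy1⟩, rfl⟩, hle⟩)
  exact ⟨y.toCLM, h1, h2, h3, fun z hz => congrFun hy ⟨z, hz⟩⟩

/-- Each condition on re T(yz) cuts out a closed subset of a compact set, and finitely many of them
are compatible. Testing against iz recovers the imaginary parts. -/
theorem IsTraceOn.exists_condExp_Icc (hT : IsTraceOn M T) {N : VonNeumannAlgebra H} (hNM : N ≤ M)
    {x : H →L[ℂ] H} (hx : x ∈ M) (hx0 : 0 ≤ x) (hx1 : x ≤ 1) :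
    ∃ y ∈ N, 0 ≤ y ∧ ∀ z ∈ N, T (y * z) = T (x * z) := by
  set C := {y : H →WOT[ℂ] H | y.toCLM ∈ N ∧ 0 ≤ y.toCLM ∧ y.toCLM ≤ 1} with hC
  have hclosed : ∀ z : N,
      IsClosed (C ∩ {y : H →WOT[ℂ] H | (T (y.toCLM * z)).re = (T (x * z)).re}) := by
    intro z
    have hc : ContinuousOn (fun y : H →WOT[ℂ] H => (T (y.toCLM * z)).re) C := by
      refine Complex.continuous_re.comp_continuousOn
        ((hT.continuousOn_mul_right (z : H →L[ℂ] H)).mono ?_)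
      rintro y ⟨-, h0, h1⟩
      exact (CStarAlgebra.norm_le_one_iff_of_nonneg _ h0).2 h1
    exact hc.preimage_isClosed_of_isClosed (isCompact_wot_Icc N).isClosed isClosed_singleton
  obtain ⟨y, ⟨hy, hy0, -⟩, hyz⟩ := (isCompact_wot_Icc N).inter_iInter_nonempty _ hclosed (by
    intro F
    obtain ⟨y, h1, h2, h3, h4⟩ := hT.exists_finset_eq hNM hx hx0 hx1 F
    refine ⟨.ofCLM y, ⟨h1, h2, h3⟩, ?_⟩
    simp only [Set.mem_iInter]
    exact fun z hz => ⟨⟨h1, h2, h3⟩, h4 z hz⟩)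
  have hre : ∀ z ∈ N, (T (y.toCLM * z)).re = (T (x * z)).re := fun z hz =>
    (Set.mem_iInter.1 hyz ⟨z, hz⟩).2
  refine ⟨y.toCLM, hy, hy0, fun z hz => Complex.ext (hre z hz) ?_⟩
  have := hre _ (smul_mem N Complex.I hz)
  simpa using this

theorem IsTraceOn.exists_condExp_nonneg (hT : IsTraceOn M T) {N : VonNeumannAlgebra H}
    (hNM : N ≤ M) {x : H →L[ℂ] H} (hx : x ∈ M) (hx0 : 0 ≤ x) :
    ∃ y ∈ N, 0 ≤ y ∧ ∀ z ∈ N, T (y * z) = T (x * z) := by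
  have hc : 0 < ‖x‖ + 1 := by positivity
  have hle : (‖x‖ + 1)⁻¹ • x ≤ 1 := by
    rw [← CStarAlgebra.norm_le_one_iff_of_nonneg _ (smul_nonneg (inv_nonneg.2 hc.le) hx0),
      norm_smul, Real.norm_of_nonneg (inv_nonneg.2 hc.le), inv_mul_le_iff₀ hc]
    linarith
  obtain ⟨y, hy, hy0, h⟩ := hT.exists_condExp_Icc hNM (real_smul_mem M _ hx)
    (smul_nonneg (inv_nonneg.2 hc.le) hx0) hle
  refine ⟨(‖x‖ + 1) • y, real_smul_mem N _ hy, smul_nonneg hc.le hy0, fun z hz => ?_⟩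
  rw [smul_mul_assoc, ← Complex.coe_smul, map_smul, h z hz, ← map_smul, Complex.coe_smul,
    ← smul_mul_assoc, smul_inv_smul₀ hc.ne']

theorem IsTraceOn.exists_condExp_selfAdjoint (hT : IsTraceOn M T) {N : VonNeumannAlgebra H}
    (hNM : N ≤ M) {x : H →L[ℂ] H} (hx : x ∈ M) (hxsa : IsSelfAdjoint x) :
    ∃ y ∈ N, ∀ z ∈ N, T (y * z) = T (x * z) := by
  have h0 : 0 ≤ x + algebraMap ℝ (H →L[ℂ] H) ‖x‖ := by
    have := hxsa.neg_algebraMap_norm_le_self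
    rwa [← sub_nonneg, sub_neg_eq_add] at this
  have hm : algebraMap ℝ (H →L[ℂ] H) ‖x‖ ∈ N := by
    rw [Algebra.algebraMap_eq_smul_one]; exact real_smul_mem N _ (one_mem N)
  obtain ⟨y, hy, -, h⟩ := hT.exists_condExp_nonneg hNM (add_mem hx (hNM hm)) h0
  refine ⟨y - algebraMap ℝ (H →L[ℂ] H) ‖x‖, sub_mem hy hm, fun z hz => ?_⟩
  rw [sub_mul, map_sub, h z hz, add_mul, _root_.map_add, add_sub_cancel_right]

theorem IsTraceOn.exists_condExp (hT : IsTraceOn M T) {N : VonNeumannAlgebra H} (hNM : N ≤ M)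
    {x : H →L[ℂ] H} (hx : x ∈ M) : ∃ y ∈ N, ∀ z ∈ N, T (y * z) = T (x * z) := by
  have hre : (realPart x : H →L[ℂ] H) ∈ M := by
    rw [realPart_apply_coe]; exact real_smul_mem M _ (add_mem hx (star_mem hx))
  have him : (imaginaryPart x : H →L[ℂ] H) ∈ M := by
    rw [imaginaryPart_apply_coe]
    exact smul_mem M _ (real_smul_mem M _ (sub_mem hx (star_mem hx)))
  obtain ⟨a, ha, ha'⟩ := hT.exists_condExp_selfAdjoint hNM hre (realPart x).2
  obtain ⟨b, hb, hb'⟩ := hT.exists_condExp_selfAdjoint hNM him (imaginaryPart x).2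
  refine ⟨a + Complex.I • b, add_mem ha (smul_mem N _ hb), fun z hz => ?_⟩
  conv_rhs => rw [← realPart_add_I_smul_imaginaryPart x]
  simp only [add_mul, smul_mul_assoc, _root_.map_add, map_smul, ha' z hz, hb' z hz]

theorem IsTraceOn.ext_of_mul (hT : IsTraceOn M T) {N : VonNeumannAlgebra H} (hNM : N ≤ M)
    {y y' : H →L[ℂ] H} (hy : y ∈ N) (hy' : y' ∈ N) (h : ∀ z ∈ N, T (y * z) = T (y' * z)) :
    y = y' := by
  have hs : y - y' ∈ N := sub_mem hy hy'
  rw [← sub_eq_zero]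
  refine hT.faithful _ (hNM hs) ?_
  rw [hT.tracial _ (star_mem (hNM hs)) _ (hNM hs), sub_mul, map_sub, h _ (star_mem hs), sub_self]

end IsTraceOn

/-- The pairings T(E(x)z) = T(xz), z ∈ N, determine E(x) ∈ N by faithfulness; linearity and the
bimodule property follow from this uniqueness, and positivity from the positive solution for x ≥ 0.
-/
theorem exists_isCondExp {M N : VonNeumannAlgebra H} (hM : ∃ τ, IsNormalizedTrace M τ)
    (hNM : N ≤ M) : ∃ E, IsCondExp M N E := by
  have htr : IsNormalizedTrace M (tr M) := by
    rw [tr, dif_pos hM]; exact hM.choose_spec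
  obtain ⟨T, hT, hTtr⟩ := htr.exists_isTraceOn
  have hex : ∀ x : Elt M, ∃ y : Elt M, (y : H →L[ℂ] H) ∈ N ∧
      ∀ z ∈ N, T (y * z) = T (x * z) := fun x => by
    obtain ⟨y, hy, h⟩ := hT.exists_condExp hNM x.2
    exact ⟨⟨y, hNM hy⟩, hy, h⟩
  choose E hEN hE using hex
  have huniq : ∀ (x : Elt M) {y : Elt M}, (y : H →L[ℂ] H) ∈ N →
      (∀ z ∈ N, T (y * z) = T (x * z)) → E x = y := fun x y hy h =>
    Subtype.ext (hT.ext_of_mul hNM (hEN x) hy fun z hz => by rw [hE x z hz, h z hz])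
  refine ⟨{ toFun := E, map_add' := fun x y => ?_, map_smul' := fun c x => ?_ },
    ⟨hEN, fun x hx => huniq x hx fun _ _ => rfl, fun x hx => ?_, fun a b ha hb x => ?_,
      fun x => ?_⟩⟩
  · refine huniq _ (add_mem (hEN x) (hEN y)) fun z hz => ?_
    simp only [AddMemClass.coe_add, add_mul, _root_.map_add, hE _ z hz]
  · refine huniq _ (smul_mem N c (hEN x)) fun z hz => ?_
    change T ((c • (E x : H →L[ℂ] H)) * z) = T ((c • (x : H →L[ℂ] H)) * z)
    rw [smul_mul_assoc, smul_mul_assoc, map_smul, map_smul, hE _ z hz]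
  · obtain ⟨y, hy, hy0, h⟩ := hT.exists_condExp_nonneg hNM x.2
      ((ContinuousLinearMap.nonneg_iff_isPositive _).2 hx)
    have : E x = ⟨y, hNM hy⟩ := huniq x hy h
    change ((E x : Elt M) : H →L[ℂ] H).IsPositive
    rw [this]
    exact (ContinuousLinearMap.nonneg_iff_isPositive _).1 hy0
  · refine huniq _ (mul_mem (mul_mem ha (hEN x)) hb) fun z hz => ?_
    change T (a * E x * b * z) = T (a * x * b * z)
    have : ∀ w : Elt M, T (a * w * b * z) = T (w * (b * z * a)) := fun w => by
      rw [mul_assoc (a : H →L[ℂ] H), mul_assoc (a : H →L[ℂ] H), hT.tracial _ a.2 _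
        (mul_mem (mul_mem w.2 b.2) (hNM hz))]
      simp only [mul_assoc]
    rw [this, this, hE x _ (mul_mem (mul_mem hb hz) ha)]
  · have := hE x 1 (one_mem N)
    rw [mul_one, mul_one, hTtr, hTtr] at this
    exact this

theorem isNormalizedTrace_tr {M : VonNeumannAlgebra H} (hM : ∃ τ, IsNormalizedTrace M τ) :
    IsNormalizedTrace M (tr M) := by
  rw [tr, dif_pos hM]; exact hM.choose_spec

theorem isCondExp_condExp {M N : VonNeumannAlgebra H} (hM : ∃ τ, IsNormalizedTrace M τ)
    (hNM : N ≤ M) : IsCondExp M N (condExp M N) := by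
  have h := exists_isCondExp hM hNM
  rw [condExp, dif_pos h]; exact h.choose_spec

/-! ### The trace norm ‖·‖₂ -/

section NormTwo

variable {M : VonNeumannAlgebra H}

theorem norm₂_nonneg (x : Elt M) : 0 ≤ norm₂ M x := Real.sqrt_nonneg _

theorem IsNormalizedTrace.re_nonneg (h : IsNormalizedTrace M (tr M)) (x : Elt M) :
    0 ≤ (tr M (star x * x)).re := (Complex.le_def.1 (h.nonneg x)).1

theorem IsNormalizedTrace.norm₂_sq (h : IsNormalizedTrace M (tr M)) (x : Elt M) :
    norm₂ M x ^ 2 = (tr M (star x * x)).re := Real.sq_sqrt (h.re_nonneg x)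

theorem IsNormalizedTrace.eq_zero_of_norm₂ (h : IsNormalizedTrace M (tr M)) {x : Elt M}
    (hx : norm₂ M x = 0) : x = 0 := by
  refine h.faithful x (Complex.ext ?_ ?_)
  · rw [← h.norm₂_sq, hx]; simp
  · exact (Complex.le_def.1 (h.nonneg x)).2.symm

theorem IsNormalizedTrace.norm₂_pos (h : IsNormalizedTrace M (tr M)) {x : Elt M}
    (hx : x ≠ 0) : 0 < norm₂ M x :=
  lt_of_le_of_ne (norm₂_nonneg x) fun h0 => hx (h.eq_zero_of_norm₂ h0.symm)

theorem IsNormalizedTrace.norm₂_star (h : IsNormalizedTrace M (tr M)) (x : Elt M) :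
    norm₂ M (star x) = norm₂ M x := by
  rw [norm₂, norm₂, star_star, h.tracial]

theorem IsNormalizedTrace.tr_star (h : IsNormalizedTrace M (tr M)) (x : Elt M) :
    tr M (star x) = star (tr M x) := by
  obtain ⟨T, hT, hTx⟩ := h.exists_isTraceOn
  rw [← hTx, ← hTx]
  exact hT.map_star x.2

theorem IsNormalizedTrace.tr_nonneg (h : IsNormalizedTrace M (tr M)) {x : Elt M}
    (hx : 0 ≤ (x : H →L[ℂ] H)) : 0 ≤ tr M x := by
  obtain ⟨T, hT, hTx⟩ := h.exists_isTraceOn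
  rw [← hTx]
  exact hT.map_nonneg x.2 hx

/-- The semi-inner product `⟨x, y⟩ = tr (x* y)`. -/
noncomputable abbrev IsNormalizedTrace.core (h : IsNormalizedTrace M (tr M)) :
    PreInnerProductSpace.Core ℂ (Elt M) where
  inner x y := tr M (star x * y)
  conj_inner_symm x y := by
    rw [← Complex.star_def, ← h.tr_star, star_mul, star_star]
  re_inner_nonneg x := h.re_nonneg x
  add_left x y z := by rw [star_add, add_mul, _root_.map_add]
  smul_left x y r := by rw [star_smul, smul_mul_assoc, map_smul]; rfl

theorem IsNormalizedTrace.norm₂_add_le (h : IsNormalizedTrace M (tr M)) (x y : Elt M) :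
    norm₂ M (x + y) ≤ norm₂ M x + norm₂ M y := by
  have hcs : (tr M (star x * y)).re ≤ norm₂ M x * norm₂ M y :=
    (Complex.re_le_norm _).trans
      (@InnerProductSpace.Core.norm_inner_le_norm ℂ (Elt M) _ _ _ h.core x y)
  have hsymm : (tr M (star y * x)).re = (tr M (star x * y)).re := by
    have := h.tr_star (star x * y)
    rw [star_mul, star_star] at this
    rw [this, Complex.star_def, Complex.conj_re]
  refine le_of_sq_le_sq ?_ (add_nonneg (norm₂_nonneg x) (norm₂_nonneg y))
  rw [h.norm₂_sq, star_add, add_mul, mul_add, mul_add]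
  simp only [_root_.map_add, Complex.add_re]
  rw [hsymm, ← h.norm₂_sq, ← h.norm₂_sq]
  nlinarith

theorem norm₂_neg (x : Elt M) : norm₂ M (-x) = norm₂ M x := by
  rw [norm₂, norm₂, star_neg, neg_mul_neg]

theorem IsNormalizedTrace.norm₂_sub_le (h : IsNormalizedTrace M (tr M)) (x y : Elt M) :
    norm₂ M (x - y) ≤ norm₂ M x + norm₂ M y := by
  rw [sub_eq_add_neg, ← norm₂_neg y]
  exact h.norm₂_add_le x (-y)

theorem IsNormalizedTrace.abs_norm₂_sub_le (h : IsNormalizedTrace M (tr M)) (x y : Elt M) :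
    |norm₂ M x - norm₂ M y| ≤ norm₂ M (x - y) := by
  have h1 := h.norm₂_add_le (x - y) y
  have h2 := h.norm₂_sub_le x (x - y)
  rw [sub_add_cancel] at h1
  rw [sub_sub_cancel] at h2
  rw [abs_le]
  constructor <;> linarith

/-- Conjugating a*a ≤ ‖a‖² by b gives (ab)*(ab) ≤ ‖a‖² b*b; then apply the trace. -/
theorem IsNormalizedTrace.norm₂_mul_le (h : IsNormalizedTrace M (tr M)) (a b : Elt M) :
    norm₂ M (a * b) ≤ ‖a‖ * norm₂ M b := by
  refine le_of_sq_le_sq ?_ (mul_nonneg (norm_nonneg a) (norm₂_nonneg b))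
  have h1 : star (a : H →L[ℂ] H) * a ≤ algebraMap ℝ (H →L[ℂ] H) (‖a‖ ^ 2) :=
    CStarAlgebra.star_mul_le_algebraMap_norm_sq
  have h2 := star_left_conjugate_nonneg (sub_nonneg.2 h1) (b : H →L[ℂ] H)
  let c : Elt M := ((‖a‖ ^ 2 : ℝ) : ℂ) • (star b * b) - star (a * b) * (a * b)
  have hc : (c : H →L[ℂ] H) =
      star (b : H →L[ℂ] H) *
        (algebraMap ℝ (H →L[ℂ] H) (‖a‖ ^ 2) - star (a : H →L[ℂ] H) * a) * b := by
    change ((‖a‖ ^ 2 : ℝ) : ℂ) • (star (b : H →L[ℂ] H) * b) -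
      star ((a : H →L[ℂ] H) * b) * (a * b) = _
    rw [Algebra.algebraMap_eq_smul_one, star_mul, mul_sub, sub_mul, Complex.coe_smul]
    simp only [mul_assoc, mul_smul_comm, smul_mul_assoc, one_mul]
  rw [← hc] at h2
  have h3 := (Complex.le_def.1 (h.tr_nonneg h2)).1
  rw [map_sub, map_smul, smul_eq_mul, Complex.sub_re, Complex.re_ofReal_mul, ← h.norm₂_sq,
    ← h.norm₂_sq, Complex.zero_re] at h3
  rw [mul_pow]
  linarith

theorem IsNormalizedTrace.norm₂_one (h : IsNormalizedTrace M (tr M)) : norm₂ M 1 = 1 := by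
  rw [norm₂, star_one, one_mul, h.map_one, Complex.one_re, Real.sqrt_one]

theorem IsNormalizedTrace.norm₂_le_norm (h : IsNormalizedTrace M (tr M)) (a : Elt M) :
    norm₂ M a ≤ ‖a‖ := by
  simpa [h.norm₂_one] using h.norm₂_mul_le a 1

theorem IsNormalizedTrace.norm₂_mul_unitary (h : IsNormalizedTrace M (tr M)) (x : Elt M)
    (u : unitary (Elt M)) : norm₂ M (x * u) = norm₂ M x := by
  rw [norm₂, norm₂, star_mul, mul_assoc, h.tracial, mul_assoc, mul_assoc]
  rw [Unitary.mul_star_self_of_mem u.2, mul_one]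

end NormTwo

/-! ### Properties of the conditional expectation -/

section CondExp

variable {M N : VonNeumannAlgebra H} {E : Elt M →ₗ[ℂ] Elt M}

theorem IsCondExp.map_mul_right (hE : IsCondExp M N E) (x : Elt M) {z : Elt M}
    (hz : (z : H →L[ℂ] H) ∈ N) : E (x * z) = E x * z := by
  simpa using hE.bimodule 1 z (one_mem N) hz x

theorem IsCondExp.map_mul_left (hE : IsCondExp M N E) (x : Elt M) {z : Elt M}
    (hz : (z : H →L[ℂ] H) ∈ N) : E (z * x) = z * E x := by
  simpa using hE.bimodule z 1 hz (one_mem N) x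

theorem IsCondExp.tr_mul (hE : IsCondExp M N E) (x : Elt M) {z : Elt M}
    (hz : (z : H →L[ℂ] H) ∈ N) : tr M (E x * z) = tr M (x * z) := by
  rw [← hE.map_mul_right x hz, hE.trace_preserving]

theorem IsCondExp.map_star (hE : IsCondExp M N E) (h : IsNormalizedTrace M (tr M)) (x : Elt M) :
    E (star x) = star (E x) := by
  have hd : ((E (star x) - star (E x) : Elt M) : H →L[ℂ] H) ∈ N :=
    sub_mem (hE.map_mem _) (star_mem (hE.map_mem x))
  rw [← sub_eq_zero]
  refine h.faithful _ ?_
  have key : ∀ z : Elt M, (z : H →L[ℂ] H) ∈ N → tr M ((E (star x) - star (E x)) * z) = 0 := by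
    intro z hz
    have h1 : tr M (star (E x) * z) = tr M (star x * z) := by
      have : tr M (star (star (E x) * z)) = tr M (star (star x * z)) := by
        rw [star_mul, star_mul, star_star, star_star, h.tracial, hE.tr_mul x (star_mem hz),
          h.tracial]
      rwa [h.tr_star, h.tr_star, star_inj] at this
    rw [sub_mul, map_sub, hE.tr_mul _ hz, h1, sub_self]
  rw [h.tracial]
  exact key _ (star_mem hd)

/-- Pythagoras: x − E x is orthogonal to N for ⟨x, y⟩ = tr(x*y). -/
theorem IsCondExp.norm₂_sq_eq (hE : IsCondExp M N E) (h : IsNormalizedTrace M (tr M))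
    (x : Elt M) : norm₂ M x ^ 2 = norm₂ M (E x) ^ 2 + norm₂ M (x - E x) ^ 2 := by
  have h1 : tr M (star x * E x) = tr M (star (E x) * E x) := by
    rw [← hE.tr_mul _ (hE.map_mem x), hE.map_star h]
  have h2 : tr M (star (E x) * x) = tr M (star (E x) * E x) := by
    rw [h.tracial, ← hE.tr_mul x (star_mem (hE.map_mem x) : ((star (E x) : Elt M) : H →L[ℂ] H) ∈ N),
      h.tracial]
  rw [h.norm₂_sq, h.norm₂_sq, h.norm₂_sq, star_sub, sub_mul, mul_sub, mul_sub]
  simp only [map_sub, h1, h2, Complex.sub_re]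
  ring

theorem IsCondExp.norm₂_le (hE : IsCondExp M N E) (h : IsNormalizedTrace M (tr M))
    (x : Elt M) : norm₂ M (E x) ≤ norm₂ M x :=
  le_of_sq_le_sq (by nlinarith [hE.norm₂_sq_eq h x, sq_nonneg (norm₂ M (x - E x))])
    (norm₂_nonneg x)

theorem IsCondExp.norm₂_sub_le (hE : IsCondExp M N E) (h : IsNormalizedTrace M (tr M))
    (x : Elt M) : norm₂ M (x - E x) ≤ norm₂ M x :=
  le_of_sq_le_sq (by nlinarith [hE.norm₂_sq_eq h x, sq_nonneg (norm₂ M (E x))])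
    (norm₂_nonneg x)

/-- The conditional expectation of a unitary is a contraction, by the Kadison–Schwarz inequality. -/
theorem IsCondExp.norm_map_unitary_le (hE : IsCondExp M N E) (h : IsNormalizedTrace M (tr M))
    {w : Elt M} (hw : star w * w = 1) : ‖E w‖ ≤ 1 := by
  have hstar : ((star (E w) : Elt M) : H →L[ℂ] H) ∈ N := star_mem (hE.map_mem w)
  -- The left side is positive, so this identity is the Schwarz inequality E(w)*E(w) ≤ 1.
  have h1 : E (star (w - E w) * (w - E w)) = 1 - star (E w) * E w := by
    rw [star_sub, sub_mul, mul_sub, mul_sub, hw]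
    simp only [map_sub]
    rw [hE.map_of_mem 1 (one_mem N), hE.map_mul_right _ (hE.map_mem w), hE.map_mul_left _ hstar,
      hE.map_star h, hE.map_of_mem (star (E w) * E w) (mul_mem hstar (hE.map_mem w))]
    abel
  have h2 := hE.positive (star (w - E w) * (w - E w))
    ((ContinuousLinearMap.nonneg_iff_isPositive _).1 (star_mul_self_nonneg ((w - E w : Elt M) :
      H →L[ℂ] H)))
  rw [h1, ← ContinuousLinearMap.nonneg_iff_isPositive] at h2
  have h3 : star ((E w : Elt M) : H →L[ℂ] H) * (E w : Elt M) ≤ 1 := sub_nonneg.1 h2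
  rw [← CStarAlgebra.norm_le_one_iff_of_nonneg _ (star_mul_self_nonneg _),
    CStarRing.norm_star_mul_self] at h3
  change ‖((E w : Elt M) : H →L[ℂ] H)‖ ≤ 1
  nlinarith [norm_nonneg ((E w : Elt M) : H →L[ℂ] H)]

end CondExp

/-! ### The asymptotic relation: masa and strong singularity -/

theorem zpow_mem {M A : VonNeumannAlgebra H} {u : unitary (Elt M)}
    (hu : ((u : Elt M) : H →L[ℂ] H) ∈ A) (k : ℤ) :
    (((u ^ k : unitary (Elt M)) : Elt M) : H →L[ℂ] H) ∈ A := by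
  have hpow : ∀ n : ℕ, (((u ^ n : unitary (Elt M)) : Elt M) : H →L[ℂ] H) ∈ A := fun n => by
    rw [SubmonoidClass.coe_pow, SubmonoidClass.coe_pow]
    exact pow_mem hu n
  cases k with
  | ofNat n => rw [Int.ofNat_eq_natCast, zpow_natCast]; exact hpow n
  | negSucc n =>
    rw [zpow_negSucc, ← Unitary.star_eq_inv]
    exact star_mem (hpow (n + 1))

/-- The unitary `u` witnesses that the conditional expectation `E` onto `A` is an asymptotic
homomorphism. -/
structure IsAsymptoticUnitary (M A : VonNeumannAlgebra H) (E : Elt M →ₗ[ℂ] Elt M)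
    (u : unitary (Elt M)) : Prop where
  mem : ((u : Elt M) : H →L[ℂ] H) ∈ A
  tendsto : ∀ x y : Elt M, Tendsto (fun k : ℤ => norm₂ M
    (E (x * ((u ^ k : unitary (Elt M)) : Elt M) * y)
      - E x * E y * ((u ^ k : unitary (Elt M)) : Elt M))) cofinite (𝓝 0)

section Asymptotic

variable {M A : VonNeumannAlgebra H} {E : Elt M →ₗ[ℂ] Elt M} {u : unitary (Elt M)}

/-- Right multiplication by uᵏ preserves ‖·‖₂, so the comparison term E(x)E(y)uᵏ has norm
independent of k. -/
theorem IsAsymptoticUnitary.tendsto_norm₂ (hu : IsAsymptoticUnitary M A E u)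
    (h : IsNormalizedTrace M (tr M)) (x y : Elt M) :
    Tendsto (fun k : ℤ => norm₂ M (E (x * ((u ^ k : unitary (Elt M)) : Elt M) * y))) cofinite
      (𝓝 (norm₂ M (E x * E y))) := by
  rw [tendsto_iff_dist_tendsto_zero]
  refine squeeze_zero (fun _ => dist_nonneg) (fun k => ?_) (hu.tendsto x y)
  rw [Real.dist_eq, ← h.norm₂_mul_unitary (E x * E y) (u ^ k)]
  exact h.abs_norm₂_sub_le _ _

/-- The relative commutant of `A` in `M` is contained in `A`. -/
theorem IsAsymptoticUnitary.mem_of_commute (hu : IsAsymptoticUnitary M A E u)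
    (hE : IsCondExp M A E) (h : IsNormalizedTrace M (tr M)) {x : Elt M}
    (hx : ∀ a : Elt M, (a : H →L[ℂ] H) ∈ A → x * a = a * x) : (x : H →L[ℂ] H) ∈ A := by
  -- Since x* commutes with uᵏ, the quantity tending to 0 does not depend on k, hence vanishes.
  have hconst : ∀ k : ℤ, norm₂ M (E (x * ((u ^ k : unitary (Elt M)) : Elt M) * star x)
      - E x * E (star x) * ((u ^ k : unitary (Elt M)) : Elt M)) =
        norm₂ M (E (x * star x) - E x * E (star x)) := by
    intro k
    have hs : star x * ((u ^ k : unitary (Elt M)) : Elt M) =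
        ((u ^ k : unitary (Elt M)) : Elt M) * star x := by
      have := hx (star ((u ^ k : unitary (Elt M)) : Elt M)) (star_mem (zpow_mem hu.mem k))
      simpa using (congrArg star this).symm
    rw [mul_assoc, ← hs, ← mul_assoc, hE.map_mul_right _ (zpow_mem hu.mem k), ← sub_mul,
      h.norm₂_mul_unitary]
  have h0 : E (x * star x) - E x * E (star x) = 0 := by
    refine h.eq_zero_of_norm₂ (tendsto_nhds_unique ?_ (hu.tendsto x (star x)))
    simp only [hconst]
    exact tendsto_const_nhds
  -- The trace of E(x x*) = E(x)E(x*) leaves no room for x* − E(x*) in Pythagoras.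
  have h1 : norm₂ M (star x) ^ 2 = norm₂ M (E (star x)) ^ 2 := by
    rw [h.norm₂_sq, h.norm₂_sq, ← hE.map_star h, star_star, ← sub_eq_zero.1 h0,
      hE.trace_preserving]
  have h2 : star x - E (star x) = 0 := by
    refine h.eq_zero_of_norm₂ (pow_eq_zero_iff two_ne_zero |>.1 ?_)
    linarith [hE.norm₂_sq_eq h (star x)]
  have h3 : ((star x : Elt M) : H →L[ℂ] H) ∈ A := by
    rw [sub_eq_zero.1 h2]; exact hE.map_mem _
  simpa using star_mem h3

theorem IsAsymptoticUnitary.isMasa (hu : IsAsymptoticUnitary M A E u)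
    (hE : IsCondExp M A E) (h : IsNormalizedTrace M (tr M)) (hAM : A ≤ M) (hA : IsAbelian A) :
    IsMasa M A := by
  refine ⟨⟨hAM, hA⟩, fun B hB hAB x hx => ?_⟩
  exact hu.mem_of_commute hE h (x := ⟨x, hB.1 hx⟩) fun a ha =>
    Subtype.ext (hB.2 x hx a (hAB ha))

/-- Pythagoras for the unitary w uᵏ w* gives 1 − ‖E(w uᵏ w*)‖₂² ≤ r². In the limit, ‖E(w)E(w*)‖₂ ≤
‖E w‖₂ because ‖E w‖ ≤ 1. -/
theorem IsAsymptoticUnitary.norm₂_sub_le_of_unitary (hu : IsAsymptoticUnitary M A E u)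
    (hE : IsCondExp M A E) (h : IsNormalizedTrace M (tr M)) (w : unitary (Elt M)) {r : ℝ}
    (hr : 0 ≤ r) (hle : ∀ k : ℤ,
      norm₂ M ((w : Elt M) * ((u ^ k : unitary (Elt M)) : Elt M) * star (w : Elt M)
        - E ((w : Elt M) * ((u ^ k : unitary (Elt M)) : Elt M) * star (w : Elt M))) ≤ r) :
    norm₂ M ((w : Elt M) - E w) ≤ r := by
  refine le_of_sq_le_sq ?_ hr
  have hone : ∀ v : unitary (Elt M), norm₂ M (v : Elt M) = 1 := fun v => by
    have := h.norm₂_mul_unitary 1 v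
    rwa [one_mul, h.norm₂_one] at this
  have hlim := (hu.tendsto_norm₂ h (w : Elt M) (star (w : Elt M))).pow 2
  have h1 : 1 - norm₂ M (E (w : Elt M) * E (star (w : Elt M))) ^ 2 ≤ r ^ 2 := by
    refine le_of_tendsto (hlim.const_sub 1) (Eventually.of_forall fun k => ?_)
    have h2 := hE.norm₂_sq_eq h
      ((w : Elt M) * ((u ^ k : unitary (Elt M)) : Elt M) * star (w : Elt M))
    have h3 := hone (w * u ^ k * star w)
    rw [Submonoid.coe_mul, Submonoid.coe_mul, Unitary.coe_star] at h3
    rw [h3] at h2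
    have h4 := pow_le_pow_left₀ (norm₂_nonneg _) (hle k) 2
    linarith
  have h2 : norm₂ M (E (w : Elt M) * E (star (w : Elt M))) ≤ norm₂ M (E (w : Elt M)) := by
    refine (h.norm₂_mul_le _ _).trans ?_
    rw [hE.map_star h, h.norm₂_star]
    exact mul_le_of_le_one_left (norm₂_nonneg _)
      (hE.norm_map_unitary_le h (Unitary.star_mul_self_of_mem w.2))
  have h3 := hE.norm₂_sq_eq h (w : Elt M)
  rw [hone w] at h3
  have h4 := pow_le_pow_left₀ (norm₂_nonneg _) h2 2
  linarith

end Asymptotic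

theorem mem_conj {u : unitary (H →L[ℂ] H)} {N : VonNeumannAlgebra H} {x : H →L[ℂ] H} :
    x ∈ conj u N ↔ ∃ y ∈ N, (u : H →L[ℂ] H) * y * star (u : H →L[ℂ] H) = x :=
  Iff.rfl

theorem conj_le {M N : VonNeumannAlgebra H} (hNM : N ≤ M) {u : unitary (H →L[ℂ] H)}
    (hu : (u : H →L[ℂ] H) ∈ M) : conj u N ≤ M := by
  intro x hx
  obtain ⟨y, hy, rfl⟩ := mem_conj.1 hx
  exact mul_mem (mul_mem hu (hNM hy)) (star_mem hu)

theorem le_normInftyTwo {M : VonNeumannAlgebra H} (h : IsNormalizedTrace M (tr M))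
    {N₁ N₂ : VonNeumannAlgebra H} {E₁ E₂ : Elt M →ₗ[ℂ] Elt M} (h₁ : IsCondExp M N₁ E₁)
    (h₂ : IsCondExp M N₂ E₂) {x : Elt M} (hx : ‖x‖ ≤ 1) :
    norm₂ M (E₁ x - E₂ x) ≤ normInftyTwo M (E₁ - E₂) := by
  -- A real supremum needs a bound: both expectations contract ‖·‖₂, so 2 works.
  refine le_csSup ⟨2, ?_⟩ ⟨x, hx, rfl⟩
  rintro _ ⟨y, hy, rfl⟩
  have h3 := (h₁.norm₂_le h y).trans ((h.norm₂_le_norm y).trans hy)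
  have h4 := (h₂.norm₂_le h y).trans ((h.norm₂_le_norm y).trans hy)
  have h5 := h.norm₂_sub_le (E₁ y) (E₂ y)
  change norm₂ M (E₁ y - E₂ y) ≤ 2
  linarith

theorem norm_unitary_le (w : H →L[ℂ] H) (hw : star w * w = 1) : ‖w‖ ≤ 1 := by
  have h : ‖star w * w‖ ≤ 1 := by
    rw [hw]; exact ContinuousLinearMap.norm_id_le
  rw [CStarRing.norm_star_mul_self] at h
  nlinarith [norm_nonneg w]

theorem IsAsymptoticUnitary.isStronglySingularMasa {M A : VonNeumannAlgebra H}
    {u : unitary (Elt M)} (hu : IsAsymptoticUnitary M A (condExp M A) u)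
    (hM : ∃ τ, IsNormalizedTrace M τ) (hAM : A ≤ M) (hA : IsAbelian A) :
    IsStronglySingularMasa M A := by
  have h := isNormalizedTrace_tr hM
  have hE := isCondExp_condExp hM hAM
  refine ⟨hu.isMasa hE h hAM hA, fun w hw => ?_⟩
  have hF := isCondExp_condExp hM (conj_le hAM hw)
  let W : unitary (Elt M) := ⟨⟨w, hw⟩, Unitary.mem_iff.2
    ⟨Subtype.ext (Unitary.star_mul_self_of_mem w.2),
      Subtype.ext (Unitary.mul_star_self_of_mem w.2)⟩⟩
  refine hu.norm₂_sub_le_of_unitary hE h W ?_ fun k => ?_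
  · exact (norm₂_nonneg _).trans (le_normInftyTwo h hF hE (x := 0) (by simp))
  -- V lies in wAw*, so the expectation onto wAw* fixes it and the difference of expectations at V
  -- is V − E(V).
  · let V : unitary (Elt M) := W * u ^ k * star W
    have hV : condExp M (conj w A) (V : Elt M) = V :=
      hF.map_of_mem _ (mem_conj.2 ⟨_, zpow_mem hu.mem k, rfl⟩)
    have h1 := le_normInftyTwo h hF hE (x := (V : Elt M))
      (norm_unitary_le _ (congrArg Subtype.val (Unitary.star_mul_self_of_mem V.2)))
    rw [hV] at h1
    exact h1

/-! ### The Popa invariant -/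

section Popa

variable {M A : VonNeumannAlgebra H} {v : Elt M}

theorem IsOrthogonalPartialIsometry.norm₂_initial_eq (h : IsNormalizedTrace M (tr M))
    (hv : IsOrthogonalPartialIsometry M A v) :
    norm₂ M (star v * v) = norm₂ M (v * star v) := by
  have h1 : v * (star v * v) = v := by rw [← mul_assoc]; exact hv.partial_isometry
  rw [norm₂, norm₂]
  congr 2
  simp only [star_mul, star_star]
  rw [mul_assoc, h1, mul_assoc, ← mul_assoc (star v), ← mul_assoc, h1, h.tracial]

/-- Since v a v* = (v a v*)(v v*), a contraction of this form has ‖·‖₂ at most ‖v v*‖₂ = ‖v*v‖₂. -/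
theorem IsOrthogonalPartialIsometry.norm₂_sub_le (h : IsNormalizedTrace M (tr M))
    (hv : IsOrthogonalPartialIsometry M A v) {E : Elt M →ₗ[ℂ] Elt M} (hE : IsCondExp M A E)
    {a : Elt M} (ha : ‖v * a * star v‖ ≤ 1) :
    norm₂ M (v * a * star v - E (v * a * star v)) ≤ norm₂ M (star v * v) := by
  have h1 : v * a * star v = v * a * star v * (v * star v) := by
    have := congrArg star hv.partial_isometry
    simp only [star_mul, star_star] at this
    rw [mul_assoc _ (star v), this]
  refine (hE.norm₂_sub_le h _).trans ?_
  rw [hv.norm₂_initial_eq h]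
  calc norm₂ M (v * a * star v) = norm₂ M (v * a * star v * (v * star v)) := by rw [← h1]
    _ ≤ ‖v * a * star v‖ * norm₂ M (v * star v) := h.norm₂_mul_le _ _
    _ ≤ norm₂ M (v * star v) := mul_le_of_le_one_left (norm₂_nonneg _) ha

theorem IsOrthogonalPartialIsometry.deltaConj_le (hM : ∃ τ, IsNormalizedTrace M τ) (hAM : A ≤ M)
    (hv : IsOrthogonalPartialIsometry M A v) :
    deltaConj M A v ≤ norm₂ M (star v * v) := by
  refine csSup_le ⟨_, 0, zero_mem A, by simp, rfl⟩ ?_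
  rintro _ ⟨a, -, ha, rfl⟩
  exact hv.norm₂_sub_le (isNormalizedTrace_tr hM) (isCondExp_condExp hM hAM) ha

theorem IsOrthogonalPartialIsometry.norm_le (hv : IsOrthogonalPartialIsometry M A v) :
    ‖v‖ ≤ 1 := by
  have h1 : (v : H →L[ℂ] H) * star (v : H →L[ℂ] H) * v = v :=
    congrArg Subtype.val hv.partial_isometry
  have h2 : IsStarProjection (star (v : H →L[ℂ] H) * v) :=
    ⟨by rw [IsIdempotentElem, mul_assoc, ← mul_assoc _ _ (v : H →L[ℂ] H), h1],
      IsSelfAdjoint.star_mul_self _⟩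
  have h3 := h2.norm_le
  rw [CStarRing.norm_star_mul_self] at h3
  change ‖(v : H →L[ℂ] H)‖ ≤ 1
  nlinarith [norm_nonneg (v : H →L[ℂ] H)]

/-- With v = (v v*) v (v*v), the two projections come out of E, and commutativity of A brings them
together, where their product is 0. -/
theorem IsOrthogonalPartialIsometry.condExp_eq_zero (hv : IsOrthogonalPartialIsometry M A v)
    {E : Elt M →ₗ[ℂ] Elt M} (hE : IsCondExp M A E) (hA : IsAbelian A) : E v = 0 := by
  have h1 : v = v * star v * v * (star v * v) := by
    rw [hv.partial_isometry, ← mul_assoc, hv.partial_isometry]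
  have hc : (v * star v) * E v = E v * (v * star v) :=
    Subtype.ext (hA _ hv.final_mem _ (hE.map_mem v))
  conv_lhs => rw [h1]
  rw [hE.bimodule _ _ hv.final_mem hv.initial_mem, hc, mul_assoc, hv.orthogonal, mul_zero]

theorem IsAsymptoticUnitary.le_deltaConj {u : unitary (Elt M)}
    (hu : IsAsymptoticUnitary M A (condExp M A) u) (hM : ∃ τ, IsNormalizedTrace M τ)
    (hAM : A ≤ M) (hA : IsAbelian A) (hv : IsOrthogonalPartialIsometry M A v) :
    norm₂ M (star v * v) ≤ deltaConj M A v := by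
  have h := isNormalizedTrace_tr hM
  have hE := isCondExp_condExp hM hAM
  have hbdd : BddAbove {r : ℝ | ∃ a : Elt M, (a : H →L[ℂ] H) ∈ A ∧ ‖v * a * star v‖ ≤ 1 ∧
      r = norm₂ M (v * a * star v - condExp M A (v * a * star v))} := by
    refine ⟨norm₂ M (star v * v), ?_⟩
    rintro _ ⟨a, -, ha, rfl⟩
    exact hv.norm₂_sub_le h hE ha
  have hle : ∀ k : ℤ, norm₂ M (v * ((u ^ k : unitary (Elt M)) : Elt M) * star v -
      condExp M A (v * ((u ^ k : unitary (Elt M)) : Elt M) * star v)) ≤ deltaConj M A v := by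
    intro k
    refine le_csSup hbdd ⟨_, zpow_mem hu.mem k, ?_, rfl⟩
    have h1 := hv.norm_le
    have h2 : ‖((u ^ k : unitary (Elt M)) : Elt M)‖ ≤ 1 :=
      norm_unitary_le _ (congrArg Subtype.val (Unitary.star_mul_self_of_mem (u ^ k).2))
    have h3 : ‖star v‖ ≤ 1 := by
      have : ‖star v‖ = ‖v‖ := norm_star (v : H →L[ℂ] H)
      rwa [this]
    calc _ ≤ ‖v‖ * ‖((u ^ k : unitary (Elt M)) : Elt M)‖ * ‖star v‖ :=
        (norm_mul_le _ _).trans (mul_le_mul_of_nonneg_right (norm_mul_le _ _) (norm_nonneg _))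
      _ ≤ 1 * 1 * 1 := by gcongr
      _ = 1 := by norm_num
  -- As v*v commutes with uᵏ, the element v uᵏ v* has (v uᵏ v*)*(v uᵏ v*) = v v*.
  have hsize : ∀ k : ℤ, norm₂ M (v * ((u ^ k : unitary (Elt M)) : Elt M) * star v) =
      norm₂ M (star v * v) := by
    intro k
    have h1 : v * (star v * v) = v := by rw [← mul_assoc]; exact hv.partial_isometry
    have hc : (star v * v) * ((u ^ k : unitary (Elt M)) : Elt M) =
        ((u ^ k : unitary (Elt M)) : Elt M) * (star v * v) :=
      Subtype.ext (hA _ hv.initial_mem _ (zpow_mem hu.mem k))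
    have hU : star ((u ^ k : unitary (Elt M)) : Elt M) * ((u ^ k : unitary (Elt M)) : Elt M) = 1 :=
      Unitary.star_mul_self_of_mem (u ^ k).2
    set U := ((u ^ k : unitary (Elt M)) : Elt M)
    rw [norm₂, norm₂]
    congr 2
    have h2 : star (v * U * star v) * (v * U * star v) = v * star v := by
      calc star (v * U * star v) * (v * U * star v)
          = v * star U * ((star v * v) * U) * star v := by
            simp only [star_mul, star_star, mul_assoc]
        _ = v * (star U * U) * (star v * v) * star v := by rw [hc]; simp only [mul_assoc]
        _ = v * star v := by rw [hU, mul_one, h1]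
    rw [h2, h.tracial v]
    congr 1
    simp only [star_mul, star_star]
    rw [mul_assoc, h1]
  have hlim := (hu.tendsto_norm₂ h v (star v)).pow 2
  rw [hv.condExp_eq_zero hE hA, zero_mul] at hlim
  have hz : norm₂ M (0 : Elt M) = 0 := by simp [norm₂]
  rw [hz] at hlim
  refine le_of_sq_le_sq ?_ ((norm₂_nonneg _).trans (hle 0))
  have h0 : Tendsto (fun k : ℤ => norm₂ M (star v * v) ^ 2 - norm₂ M (condExp M A
      (v * ((u ^ k : unitary (Elt M)) : Elt M) * star v)) ^ 2) cofinite
      (𝓝 (norm₂ M (star v * v) ^ 2)) := by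
    simpa using hlim.const_sub (norm₂ M (star v * v) ^ 2)
  refine le_of_tendsto h0 (Eventually.of_forall fun k => ?_)
  have h1 := hE.norm₂_sq_eq h (v * ((u ^ k : unitary (Elt M)) : Elt M) * star v)
  rw [hsize] at h1
  have h2 := pow_le_pow_left₀ (norm₂_nonneg _) (hle k) 2
  linarith

/-- Without an admissible v every real number would satisfy the defining condition and there would
be no greatest one, hence `hv`. -/
theorem IsAsymptoticUnitary.hasPopaInvariant {u : unitary (Elt M)}
    (hu : IsAsymptoticUnitary M A (condExp M A) u) (hM : ∃ τ, IsNormalizedTrace M τ)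
    (hAM : A ≤ M) (hA : IsAbelian A) (hv : ∃ v, IsOrthogonalPartialIsometry M A v) :
    HasPopaInvariant M A 1 := by
  refine ⟨fun v hv => ?_, fun l hl => ?_⟩
  · rw [one_mul]
    exact hu.le_deltaConj hM hAM hA hv
  · obtain ⟨v, hv⟩ := hv
    have h1 := (hl v hv).trans (hv.deltaConj_le hM hAM)
    have hpos : 0 < norm₂ M (star v * v) := by
      refine (isNormalizedTrace_tr hM).norm₂_pos fun h0 => hv.ne_zero ?_
      rw [← hv.partial_isometry, mul_assoc, h0, mul_zero]
    exact le_of_mul_le_mul_right (by rwa [one_mul]) hpos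

end Popa

/-! ### Comparison of projections in a factor -/

theorem eq_zero_of_mem_extremePoints {V : Type*} [AddCommGroup V] [Module ℝ V] {S : Set V}
    {a h : V} (ha : a ∈ S.extremePoints ℝ) (h₁ : a + h ∈ S) (h₂ : a - h ∈ S) : h = 0 := by
  have := (mem_extremePoints.1 ha).2 _ h₁ _ h₂
    ⟨2⁻¹, 2⁻¹, by norm_num, by norm_num, by norm_num, by module⟩
  simpa using this.1

theorem le_one_of_norm_le {z : H →L[ℂ] H} (hz : IsSelfAdjoint z) (h : ‖z‖ ≤ 1) : z ≤ 1 := by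
  refine hz.le_algebraMap_norm_self.trans ?_
  rw [← map_one (algebraMap ℝ (H →L[ℂ] H))]
  exact algebraMap_mono _ h

theorem norm_le_one_of_star_mul_le {w : H →L[ℂ] H} (h : star w * w ≤ 1) : ‖w‖ ≤ 1 := by
  rw [← CStarAlgebra.norm_le_one_iff_of_nonneg _ (star_mul_self_nonneg w),
    CStarRing.norm_star_mul_self] at h
  nlinarith [norm_nonneg w]

theorem star_mul_le_one_of_norm_le {w : H →L[ℂ] H} (h : ‖w‖ ≤ 1) : star w * w ≤ 1 := by
  rw [← CStarAlgebra.norm_le_one_iff_of_nonneg _ (star_mul_self_nonneg w),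
    CStarRing.norm_star_mul_self]
  nlinarith [norm_nonneg w]

/-- In a factor, `q M p = 0` implies `q = 0` or `p = 0`. -/
theorem IsFactor.eq_zero_or_eq_zero {M : VonNeumannAlgebra H} (hM : IsFactor M)
    {p q : H →L[ℂ] H} (hq : q ∈ M) (h : ∀ x ∈ M, q * x * p = 0) :
    q = 0 ∨ p = 0 := by
  -- K = {ξ : q M ξ = 0} is invariant under M and under M', so its projection is a scalar: either K
  -- = 0, which contains the range of p, or K = H and q = 0.
  let K : Submodule ℂ H := ⨅ m : M, LinearMap.ker ((q * (m : H →L[ℂ] H) : H →L[ℂ] H) : H →ₗ[ℂ] H)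
  have hK : ∀ {ξ : H}, ξ ∈ K ↔ ∀ m ∈ M, q (m ξ) = 0 := by
    intro ξ
    simp [K, Submodule.mem_iInf]
  have hcl : IsClosed (K : Set H) := by
    have : (K : Set H) = ⋂ m : M, {ξ : H | q ((m : H →L[ℂ] H) ξ) = 0} := by
      ext ξ; simp [hK]
    rw [this]
    exact isClosed_iInter fun m =>
      isClosed_eq (q.continuous.comp (m : H →L[ℂ] H).continuous) continuous_const
  have : CompleteSpace K := hcl.completeSpace_coe
  have hP : IsStarProjection K.starProjection := isStarProjection_starProjection
  have hr : LinearMap.range (K.starProjection : H →ₗ[ℂ] H) = K := K.range_starProjection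
  have h1 : K.starProjection ∈ M := by
    rw [VonNeumannAlgebra.IsStarProjection.mem_iff hP]
    intro y hy
    rw [hr, Module.End.mem_invtSubmodule]
    intro ξ hξ
    refine hK.2 fun m hm => ?_
    have hc := VonNeumannAlgebra.mem_commutant_iff.1 hy (q * m) (mul_mem hq hm)
    have : q (m (y ξ)) = y (q (m ξ)) := congrArg (fun T : H →L[ℂ] H => T ξ) hc
    change q (m (y ξ)) = 0
    rw [this, hK.1 hξ m hm, map_zero]
  have h2 : K.starProjection ∈ M.commutant := by
    rw [VonNeumannAlgebra.IsStarProjection.mem_iff hP]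
    intro y hy
    rw [VonNeumannAlgebra.commutant_commutant] at hy
    rw [hr, Module.End.mem_invtSubmodule]
    intro ξ hξ
    exact hK.2 fun m hm => hK.1 hξ (m * y) (mul_mem hm hy)
  obtain ⟨c, hc⟩ := hM _ h1 h2
  have hpK : ∀ ξ, p ξ ∈ K := fun ξ => hK.2 fun m hm =>
    congrArg (fun T : H →L[ℂ] H => T ξ) (h m hm)
  by_cases hc0 : c = 0
  · right
    ext ξ
    have := Submodule.starProjection_eq_self_iff.2 (hpK ξ)
    rw [hc, hc0] at this
    simpa using this.symm
  · left
    ext ξ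
    have hmem : K.starProjection (c⁻¹ • ξ) ∈ K := K.starProjection_apply_mem _
    rw [hc] at hmem
    have : ξ ∈ K := by simpa [smul_smul, hc0] using hmem
    exact hK.1 this 1 (one_mem M)

section PartialIsometry

variable {M : VonNeumannAlgebra H} {e f : H →L[ℂ] H}

/-- The contractions in `f M e`. -/
def cornerBall (M : VonNeumannAlgebra H) (e f : H →L[ℂ] H) : Set (H →WOT[ℂ] H) :=
  {v | ‖v.toCLM‖ ≤ 1} ∩
    ({v | v.toCLM ∈ M} ∩ ({v | f * v.toCLM = v.toCLM} ∩ {v | v.toCLM * e = v.toCLM}))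

theorem isCompact_cornerBall : IsCompact (cornerBall M e f) :=
  isCompact_unitBall_wot.inter_right ((isClosed_wot_mem M).inter
    ((isClosed_wot_eq (continuous_wot_mul_left f) continuous_id).inter
      (isClosed_wot_eq (continuous_wot_mul_right e) continuous_id)))

/-- With b = v*v the operator is w = v(3 − b)/2, and 4(1 − w*w) = 4 − b(3 − b)² = (1 − b)²(4 − b) ≥
0. -/
theorem norm_half_three_sub_le {v : H →L[ℂ] H} (hv : ‖v‖ ≤ 1) :
    ‖v + (2⁻¹ : ℝ) • (v - v * (star v * v))‖ ≤ 1 := by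
  set b := star v * v with hb
  have hb0 : 0 ≤ b := star_mul_self_nonneg v
  have hbs : star b = b := (IsSelfAdjoint.of_nonneg hb0).star_eq
  have hb1 : b ≤ 1 := star_mul_le_one_of_norm_le hv
  have h4 : (0 : H →L[ℂ] H) ≤ 1 + 1 + 1 + 1 - b := by
    have : (1 : H →L[ℂ] H) + 1 + 1 + 1 - b = (1 - b) + (1 + 1 + 1) := by noncomm_ring
    rw [this]
    have h01 : (0 : H →L[ℂ] H) ≤ 1 := by simp
    exact add_nonneg (sub_nonneg.2 hb1) (add_nonneg (add_nonneg h01 h01) h01)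
  have key : 0 ≤ star (1 - b) * (1 + 1 + 1 + 1 - b) * (1 - b) := star_left_conjugate_nonneg h4 _
  have hw : v + (2⁻¹ : ℝ) • (v - v * b) = (2⁻¹ : ℝ) • (v * (1 + 1 + 1 - b)) := by
    have : v * (1 + 1 + 1 - b) = v + v + v - v * b := by
      rw [mul_sub, mul_add, mul_add, mul_one]
    rw [this]; module
  refine norm_le_one_of_star_mul_le ?_
  rw [hw, star_smul, smul_mul_smul_comm, star_trivial, ← sub_nonneg]
  have heq : 1 - (2⁻¹ * 2⁻¹ : ℝ) • (star (v * (1 + 1 + 1 - b)) * (v * (1 + 1 + 1 - b))) =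
      (2⁻¹ * 2⁻¹ : ℝ) • (star (1 - b) * (1 + 1 + 1 + 1 - b) * (1 - b)) := by
    have h3 : star (v * (1 + 1 + 1 - b)) * (v * (1 + 1 + 1 - b)) =
        (1 + 1 + 1 - b) * b * (1 + 1 + 1 - b) := by
      rw [star_mul, star_sub, star_add, star_add, star_one, hbs]
      simp only [hb, mul_assoc]
    have h1 : (1 : H →L[ℂ] H) = (2⁻¹ * 2⁻¹ : ℝ) • (1 + 1 + 1 + 1) := by module
    rw [h3, star_sub, star_one, hbs]
    refine (congrArg (· - _) h1).trans ?_
    rw [← smul_sub]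
    congr 1
    noncomm_ring
  rw [heq]
  exact smul_nonneg (by norm_num) key

theorem norm_half_add_le {v : H →L[ℂ] H} (hv : ‖v‖ ≤ 1) :
    ‖v - (2⁻¹ : ℝ) • (v - v * (star v * v))‖ ≤ 1 := by
  have h1 : v - (2⁻¹ : ℝ) • (v - v * (star v * v)) = (2⁻¹ : ℝ) • (v + v * (star v * v)) := by
    module
  have h2 : ‖v * (star v * v)‖ ≤ 1 := by
    refine (norm_mul_le _ _).trans ?_
    rw [CStarRing.norm_star_mul_self]
    have := norm_nonneg v
    exact mul_le_one₀ hv (by positivity) (mul_le_one₀ hv this hv)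
  rw [h1, norm_smul, Real.norm_of_nonneg (by norm_num)]
  have := norm_add_le v (v * (star v * v))
  linarith

/-- The ranges are orthogonal, so the cross terms vanish and (v + y)*(v + y) = v*v + y*y ≤ e. -/
theorem norm_add_le_one_of_orthogonal {v y : H →L[ℂ] H} (he : e ≤ 1) (hvy : star v * y = 0)
    (hy : star y * y ≤ e - star v * v) : ‖v + y‖ ≤ 1 := by
  refine norm_le_one_of_star_mul_le ?_
  have hyv : star y * v = 0 := by simpa using congrArg star hvy
  rw [star_add, add_mul, mul_add, mul_add, hvy, hyv, add_zero, zero_add]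
  calc star v * v + star y * y ≤ star v * v + (e - star v * v) := by gcongr
    _ = e := by abel
    _ ≤ 1 := he

/-- An extreme point of the unit ball of `f M e` is a partial isometry `v` such that
`(f - v v*) M (e - v* v) = 0`. -/
theorem exists_maximal_partialIsometry (he : IsStarProjection e) (hf : IsStarProjection f)
    (heM : e ∈ M) (hfM : f ∈ M) :
    ∃ v ∈ M, f * v = v ∧ v * e = v ∧ v * star v * v = v ∧
      ∀ x ∈ M, (f - v * star v) * x * (e - star v * v) = 0 := by
  obtain ⟨w, hw⟩ := (isCompact_cornerBall (M := M) (e := e) (f := f)).extremePoints_nonempty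
    ⟨0, by simp [cornerBall]⟩
  obtain ⟨hw1, hwM, hwf, hwe⟩ := hw.1
  set v : H →L[ℂ] H := w.toCLM with hv
  simp only [Set.mem_ofPred_eq] at hw1 hwM hwf hwe
  have hext : ∀ h ∈ M, f * h = h → h * e = h → ‖v + h‖ ≤ 1 → ‖v - h‖ ≤ 1 → h = 0 := by
    intro h hh hfh hhe h₁ h₂
    have := eq_zero_of_mem_extremePoints (h := ContinuousLinearMapWOT.ofCLM h) hw
      ⟨h₁, add_mem hwM hh, (by
        change f * (v + h) = v + h
        rw [mul_add, hwf, hfh]), (by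
        change (v + h) * e = v + h
        rw [add_mul, hwe, hhe])⟩
      ⟨h₂, sub_mem hwM hh, (by
        change f * (v - h) = v - h
        rw [mul_sub, hwf, hfh]), (by
        change (v - h) * e = v - h
        rw [sub_mul, hwe, hhe])⟩
    exact congrArg ContinuousLinearMapWOT.toCLM this
  -- Perturbing v by ±(v − v v*v)/2 stays in the ball, so extremality kills the perturbation.
  have hiso : v * star v * v = v := by
    have h0 := hext ((2⁻¹ : ℝ) • (v - v * (star v * v)))
      (real_smul_mem M _ (sub_mem hwM (mul_mem hwM (mul_mem (star_mem hwM) hwM))))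
      (by rw [mul_smul_comm, mul_sub, ← mul_assoc, hwf])
      (by rw [smul_mul_assoc, sub_mul, mul_assoc, mul_assoc, hwe])
      (norm_half_three_sub_le hw1) (norm_half_add_le hw1)
    rw [smul_eq_zero_iff_right (by norm_num), sub_eq_zero] at h0
    rw [mul_assoc]; exact h0.symm
  refine ⟨v, hwM, hwf, hwe, hiso, fun x hx => ?_⟩
  set b := star v * v with hb
  set q := f - v * star v with hq
  set p := e - b with hp
  have hse : e * star v = star v := by
    have := congrArg star hwe
    rwa [star_mul, he.isSelfAdjoint.star_eq] at this
  have hsf : star v * f = star v := by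
    have := congrArg star hwf
    rwa [star_mul, hf.isSelfAdjoint.star_eq] at this
  have hiso' : star v * v * star v = star v := by
    have := congrArg star hiso
    simpa [mul_assoc] using this
  have hbs : star b = b := (IsSelfAdjoint.star_mul_self v).star_eq
  have hpp : p * p = p := by
    have h1 : e * b = b := by rw [hb, ← mul_assoc, hse]
    have h2 : b * e = b := by rw [hb, mul_assoc, hwe]
    have h3 : b * b = b := by rw [hb, ← mul_assoc, hiso']
    have h4 : e * e = e := he.isIdempotentElem
    rw [hp, mul_sub, sub_mul, sub_mul, h1, h2, h3, h4]; abel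
  have hps : star p = p := by rw [hp, star_sub, hbs, he.isSelfAdjoint.star_eq]
  have hpe : p * e = p := by
    rw [hp, sub_mul, hb, mul_assoc, hwe, he.isIdempotentElem.eq]
  have hfq : f * q = q := by
    rw [hq, mul_sub, ← mul_assoc, hwf, hf.isIdempotentElem.eq]
  have hvq : star v * q = 0 := by
    rw [hq, mul_sub, hsf, ← mul_assoc, hiso', sub_self]
  have hqM : q ∈ M := sub_mem hfM (mul_mem hwM (star_mem hwM))
  have hpM : p ∈ M := sub_mem heM (mul_mem (star_mem hwM) hwM)
  set z := q * x * p with hz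
  have hc : 0 < ‖z‖ + 1 := by positivity
  -- Scaled to a contraction, z ∈ qMp can be added to v or subtracted from it within the ball;
  -- extremality gives z = 0.
  set y := (‖z‖ + 1)⁻¹ • z with hy
  have hyM : y ∈ M := real_smul_mem M _ (mul_mem (mul_mem hqM hx) hpM)
  have hyn : ‖y‖ ≤ 1 := by
    rw [hy, norm_smul, Real.norm_of_nonneg (inv_nonneg.2 hc.le), inv_mul_le_iff₀ hc]
    linarith
  have hyp : y * p = y := by rw [hy, smul_mul_assoc, hz, mul_assoc _ p p, hpp]
  have hvy : star v * y = 0 := by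
    rw [hy, mul_smul_comm, hz, ← mul_assoc, ← mul_assoc, hvq, zero_mul, zero_mul, smul_zero]
  have hyy : star y * y ≤ p := by
    have h1 : star p * (star y * y) * p ≤ star p * 1 * p :=
      star_left_conjugate_le_conjugate (star_mul_le_one_of_norm_le hyn) p
    have h2 : star p * (star y * y) * p = star y * y := by
      rw [← mul_assoc, ← star_mul, hyp, mul_assoc, hyp]
    rwa [h2, mul_one, hps, hpp] at h1
  have h0 := hext y hyM
    (by rw [hy, mul_smul_comm, hz, ← mul_assoc, ← mul_assoc, hfq])
    (by rw [hy, smul_mul_assoc, hz, mul_assoc _ p e, hpe])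
    (norm_add_le_one_of_orthogonal he.le_one hvy hyy)
    (by
      rw [sub_eq_add_neg]
      exact norm_add_le_one_of_orthogonal he.le_one (by rw [mul_neg, hvy, neg_zero])
        (by rw [star_neg, neg_mul_neg]; exact hyy))
  rwa [hy, smul_eq_zero_iff_right (inv_ne_zero hc.ne')] at h0

/-- In a factor, projections of the same trace are equivalent. -/
theorem IsTraceOn.exists_partialIsometry {T : (H →L[ℂ] H) →ₗ[ℂ] ℂ} (hT : IsTraceOn M T)
    (hM : IsFactor M) (he : IsStarProjection e) (hf : IsStarProjection f)
    (heM : e ∈ M) (hfM : f ∈ M) (hef : T e = T f) :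
    ∃ v ∈ M, v * star v = f ∧ star v * v = e := by
  obtain ⟨v, hvM, hfv, hve, hiso, hmax⟩ := exists_maximal_partialIsometry he hf heM hfM
  have hqM : f - v * star v ∈ M := sub_mem hfM (mul_mem hvM (star_mem hvM))
  have hpM : e - star v * v ∈ M := sub_mem heM (mul_mem (star_mem hvM) hvM)
  have hvn : ‖v‖ ≤ 1 := by
    refine norm_le_one_of_star_mul_le (IsStarProjection.le_one
      ⟨by rw [IsIdempotentElem, mul_assoc, ← mul_assoc _ _ v, hiso],
        IsSelfAdjoint.star_mul_self _⟩)
  have hse : e * star v = star v := by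
    have := congrArg star hve
    rwa [star_mul, he.isSelfAdjoint.star_eq] at this
  have hsf : star v * f = star v := by
    have := congrArg star hfv
    rwa [star_mul, hf.isSelfAdjoint.star_eq] at this
  have hp0 : 0 ≤ e - star v * v := by
    have h1 := star_left_conjugate_le_conjugate (star_mul_le_one_of_norm_le hvn) e
    rw [he.isSelfAdjoint.star_eq, mul_one, he.isIdempotentElem.eq, ← mul_assoc, hse, mul_assoc,
      hve] at h1
    exact sub_nonneg.2 h1
  have hq0 : 0 ≤ f - v * star v := by
    have h1 := star_left_conjugate_le_conjugate
      (star_mul_le_one_of_norm_le (w := star v) (by rwa [norm_star])) f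
    rw [star_star, hf.isSelfAdjoint.star_eq, mul_one, hf.isIdempotentElem.eq, ← mul_assoc, hfv,
      mul_assoc, hsf] at h1
    exact sub_nonneg.2 h1
  have htr : T (f - v * star v) = T (e - star v * v) := by
    rw [map_sub, map_sub, hef, hT.tracial v hvM _ (star_mem hvM)]
  -- One leftover projection vanishes because M is a factor; the other has the same trace, so
  -- faithfulness kills it too.
  have hpq : f - v * star v = 0 ∧ e - star v * v = 0 := by
    rcases hM.eq_zero_or_eq_zero hqM hmax with h | h
    · exact ⟨h, hT.eq_zero_of_nonneg hpM hp0 (by rw [← htr, h, map_zero])⟩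
    · exact ⟨hT.eq_zero_of_nonneg hqM hq0 (by rw [htr, h, map_zero]), h⟩
  exact ⟨v, hvM, (sub_eq_zero.1 hpq.1).symm, (sub_eq_zero.1 hpq.2).symm⟩

end PartialIsometry

/-! ### A projection of trace 1/2 in A -/

/-- The element is a(1 + (1 − a)d) and its complement is (1 − a)(1 − ad), both products of commuting
positive operators. -/
theorem add_mul_one_sub_mem_Icc {a d : H →L[ℂ] H} (ha0 : 0 ≤ a) (ha1 : a ≤ 1)
    (had : Commute a d) (hd : IsSelfAdjoint d) (hdn : ‖d‖ ≤ 1) :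
    0 ≤ a + a * (1 - a) * d ∧ a + a * (1 - a) * d ≤ 1 := by
  have hcomm : Commute (1 - a) d := (Commute.one_left d).sub_left had
  have hself : Commute a (1 - a) := (Commute.one_right a).sub_right (Commute.refl a)
  have hb0 : 0 ≤ 1 - a := sub_nonneg.2 ha1
  have hb1 : 1 - a ≤ 1 := sub_le_self _ ha0
  have key : ∀ c : H →L[ℂ] H, 0 ≤ c → c ≤ 1 → Commute c d → ∀ s : H →L[ℂ] H,
      s = c * d → IsSelfAdjoint s ∧ ‖s‖ ≤ 1 := by
    rintro c hc0 hc1 hcd s rfl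
    refine ⟨(IsSelfAdjoint.commute_iff (.of_nonneg hc0) hd).1 hcd, (norm_mul_le _ _).trans ?_⟩
    exact mul_le_one₀ ((CStarAlgebra.norm_le_one_iff_of_nonneg c hc0).2 hc1) (norm_nonneg d) hdn
  obtain ⟨h1, h2⟩ := key (1 - a) hb0 hb1 hcomm _ rfl
  obtain ⟨h3, h4⟩ := key a ha0 ha1 had _ rfl
  have h5 : 0 ≤ 1 + (1 - a) * d := by
    have := le_one_of_norm_le h1.neg (by rwa [norm_neg])
    rw [← sub_nonneg] at this
    simpa using this
  have h6 : 0 ≤ 1 - a * d := sub_nonneg.2 (le_one_of_norm_le h3 h4)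
  constructor
  · have : a + a * (1 - a) * d = a * (1 + (1 - a) * d) := by noncomm_ring
    rw [this]
    exact Commute.mul_nonneg ha0 h5 ((Commute.one_right a).add_right (hself.mul_right had))
  · have : 1 - (a + a * (1 - a) * d) = (1 - a) * (1 - a * d) := by
      rw [hself.eq]; noncomm_ring
    rw [← sub_nonneg, this]
    exact Commute.mul_nonneg hb0 h6
      ((Commute.one_right _).sub_right (hself.symm.mul_right hcomm))

/-- In an abelian algebra without minimal projections, an extreme point of
`{a ∈ A | 0 ≤ a ≤ 1, T a = 1/2}` is a projection. -/
theorem IsTraceOn.exists_projection_half {M A : VonNeumannAlgebra H} {T : (H →L[ℂ] H) →ₗ[ℂ] ℂ}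
    (hT : IsTraceOn M T) (hAM : A ≤ M) (hA : IsAbelian A)
    (hdiff : ∀ c ∈ A, IsSelfAdjoint c → (∀ d ∈ A, ∃ r : ℂ, c * d = r • c) → c = 0) :
    ∃ e ∈ A, IsStarProjection e ∧ T e = 2⁻¹ := by
  set C := {y : H →WOT[ℂ] H | y.toCLM ∈ A ∧ 0 ≤ y.toCLM ∧ y.toCLM ≤ 1}
  set D := C ∩ {y | T y.toCLM = 2⁻¹} with hD
  have hDc : IsCompact D := by
    have hc : ContinuousOn (fun y : H →WOT[ℂ] H => T y.toCLM) C := by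
      refine (hT.continuousOn 1).mono ?_
      rintro y ⟨-, h0, h1⟩
      exact (CStarAlgebra.norm_le_one_iff_of_nonneg _ h0).2 h1
    exact (isCompact_wot_Icc A).of_isClosed_subset
      (hc.preimage_isClosed_of_isClosed (isCompact_wot_Icc A).isClosed isClosed_singleton)
      Set.inter_subset_left
  have h01 : (0 : H →L[ℂ] H) ≤ 1 := by simp
  have hne : D.Nonempty := by
    refine ⟨.ofCLM ((2⁻¹ : ℝ) • 1), ⟨real_smul_mem A _ (one_mem A), ?_, ?_⟩, ?_⟩
    · exact smul_nonneg (by norm_num) h01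
    · change (2⁻¹ : ℝ) • (1 : H →L[ℂ] H) ≤ 1
      calc (2⁻¹ : ℝ) • (1 : H →L[ℂ] H) ≤ (1 : ℝ) • (1 : H →L[ℂ] H) :=
            smul_le_smul_of_nonneg_right (by norm_num) h01
        _ = 1 := one_smul _ _
    · change T ((2⁻¹ : ℝ) • 1) = 2⁻¹
      rw [← Complex.coe_smul, map_smul, hT.map_one]
      simp
  obtain ⟨w, hw⟩ := hDc.extremePoints_nonempty hne
  obtain ⟨⟨haA, ha0, ha1⟩, haT⟩ := hw.1
  set a : H →L[ℂ] H := w.toCLM with ha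
  have has : IsSelfAdjoint a := .of_nonneg ha0
  set c := a * (1 - a) with hc
  have hcA : c ∈ A := mul_mem haA (sub_mem (one_mem A) haA)
  have hself : Commute a (1 - a) := (Commute.one_right a).sub_right (Commute.refl a)
  have hc0 : 0 ≤ c := Commute.mul_nonneg ha0 (sub_nonneg.2 ha1) hself
  have hcs : IsSelfAdjoint c := .of_nonneg hc0
  -- When T(cd) = 0, both a + cd and a − cd still have trace 1/2 and lie between 0 and 1.
  have hball : ∀ d ∈ A, IsSelfAdjoint d → ‖d‖ ≤ 1 → T (c * d) = 0 → c * d = 0 := by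
    intro d hd hds hdn hTd
    have h₁ := add_mul_one_sub_mem_Icc ha0 ha1 (hA a haA d hd) hds hdn
    have h₂ := add_mul_one_sub_mem_Icc ha0 ha1 (hA a haA (-d) (neg_mem hd)) hds.neg
      (by rwa [norm_neg])
    rw [mul_neg, ← sub_eq_add_neg] at h₂
    have := eq_zero_of_mem_extremePoints (h := ContinuousLinearMapWOT.ofCLM (c * d)) hw
      ⟨⟨add_mem haA (mul_mem hcA hd), h₁⟩, (by
        change T (a + c * d) = 2⁻¹
        rw [_root_.map_add, hTd, add_zero]; exact haT)⟩
      ⟨⟨sub_mem haA (mul_mem hcA hd), h₂⟩, (by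
        change T (a - c * d) = 2⁻¹
        rw [map_sub, hTd, sub_zero]; exact haT)⟩
    exact congrArg ContinuousLinearMapWOT.toCLM this
  have hker : ∀ d ∈ A, IsSelfAdjoint d → T (c * d) = 0 → c * d = 0 := by
    intro d hd hds hTd
    have hpos : 0 < ‖d‖ + 1 := by positivity
    have := hball ((‖d‖ + 1)⁻¹ • d) (real_smul_mem A _ hd)
      ((IsSelfAdjoint.all ((‖d‖ + 1)⁻¹ : ℝ)).smul hds) (by
        rw [norm_smul, Real.norm_of_nonneg (inv_nonneg.2 hpos.le), inv_mul_le_iff₀ hpos]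
        linarith) (by
        rw [mul_smul_comm, ← Complex.coe_smul, map_smul, hTd, smul_zero])
    rwa [mul_smul_comm, smul_eq_zero_iff_right (inv_ne_zero hpos.ne')] at this
  have hczero : c = 0 := by
    by_contra hcne
    have hTc : T c ≠ 0 := fun h => hcne (hT.eq_zero_of_nonneg (hAM hcA) hc0 h)
    have hTcim : (T c).im = 0 := (Complex.le_def.1 (hT.map_nonneg (hAM hcA) hc0)).2.symm
    have hTcre : (T c).re ≠ 0 := fun h => hTc (Complex.ext h hTcim)
    have hsa : ∀ d ∈ A, IsSelfAdjoint d → ∃ r : ℂ, c * d = r • c := by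
      intro d hd hds
      -- Chosen so that T(c(d − r)) = 0; then cd = rc, so Ac is one-dimensional and `hdiff` applies.
      set r : ℝ := (T (c * d)).re / (T c).re with hr
      have him : (T (c * d)).im = 0 := by
        have h := hT.map_star (mul_mem (hAM hcA) (hAM hd))
        rw [star_mul, hds.star_eq, hcs.star_eq, hT.tracial _ (hAM hd) _ (hAM hcA)] at h
        exact Complex.conj_eq_iff_im.1 h.symm
      have := hker (d - r • 1) (sub_mem hd (real_smul_mem A _ (one_mem A)))
        (hds.sub ((IsSelfAdjoint.all r).smul (IsSelfAdjoint.one _))) (by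
          rw [mul_sub, mul_smul_comm, mul_one, map_sub, ← Complex.coe_smul, map_smul]
          apply Complex.ext
          · simp [hr, hTcre]
          · simp [him, hTcim])
      refine ⟨r, ?_⟩
      rw [mul_sub, mul_smul_comm, mul_one, sub_eq_zero] at this
      rw [this, Complex.coe_smul]
    refine hcne (hdiff c hcA hcs fun d hd => ?_)
    have hre : (realPart d : H →L[ℂ] H) ∈ A := by
      rw [realPart_apply_coe]; exact real_smul_mem A _ (add_mem hd (star_mem hd))
    have him : (imaginaryPart d : H →L[ℂ] H) ∈ A := by
      rw [imaginaryPart_apply_coe]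
      exact smul_mem A _ (real_smul_mem A _ (sub_mem hd (star_mem hd)))
    obtain ⟨r, hr⟩ := hsa _ hre (realPart d).2
    obtain ⟨s, hs⟩ := hsa _ him (imaginaryPart d).2
    refine ⟨r + Complex.I * s, ?_⟩
    rw [← realPart_add_I_smul_imaginaryPart d, mul_add, mul_smul_comm, hr, hs, smul_smul, add_smul]
  refine ⟨a, haA, ⟨?_, has⟩, haT⟩
  rw [hc, mul_sub, mul_one, sub_eq_zero] at hczero
  exact hczero.symm

theorem IsNormalizedTrace.norm₂_smul {M : VonNeumannAlgebra H}
    (h : IsNormalizedTrace M (tr M)) (c : ℂ) (x : Elt M) :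
    norm₂ M (c • x) = ‖c‖ * norm₂ M x := by
  rw [← sq_eq_sq₀ (norm₂_nonneg _) (mul_nonneg (norm_nonneg _) (norm₂_nonneg _)), mul_pow,
    h.norm₂_sq, h.norm₂_sq, star_smul, smul_mul_smul_comm, map_smul, Complex.star_def,
    Complex.conj_mul', smul_eq_mul, ← Complex.ofReal_pow, Complex.re_ofReal_mul]

/-! ### Absence of minimal projections and existence of an admissible v -/

section Asymptotic

variable {M A : VonNeumannAlgebra H} {E : Elt M →ₗ[ℂ] Elt M} {u : unitary (Elt M)}

/-- If `A c` is one-dimensional for some `c ∈ A`, then `x c = E(x) c` for all `x ∈ M`. -/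
theorem IsAsymptoticUnitary.mul_eq_of_minimal (hu : IsAsymptoticUnitary M A E u)
    (hE : IsCondExp M A E) (h : IsNormalizedTrace M (tr M)) {c : Elt M}
    (hc : (c : H →L[ℂ] H) ∈ A)
    (hmin : ∀ d : Elt M, (d : H →L[ℂ] H) ∈ A → ∃ r : ℂ, c * d = r • c) (x : Elt M) :
    x * c = E x * c := by
  by_cases hc0 : c = 0
  · rw [hc0, mul_zero, mul_zero]
  set y := x - E x with hy
  have hEy : E y = 0 := by
    rw [hy, map_sub, hE.map_of_mem _ (hE.map_mem x), sub_self]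
  have hlim := hu.tendsto_norm₂ h (y * c) (star (y * c))
  have hzero : norm₂ M (0 : Elt M) = 0 := by simp [norm₂]
  rw [hE.map_mul_right _ hc, hEy, zero_mul, zero_mul, hzero] at hlim
  -- Minimality gives c uᵏ = r c with |r| = 1, so these norms are constant in k; their limit is 0
  -- because E(yc) = E(y)c = 0.
  have hconst : ∀ k : ℤ,
      norm₂ M (E (y * c * ((u ^ k : unitary (Elt M)) : Elt M) * star (y * c))) =
        norm₂ M (E (y * c * star (y * c))) := by
    intro k
    obtain ⟨r, hr⟩ := hmin _ (zpow_mem hu.mem k)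
    have hr1 : ‖r‖ = 1 := by
      have h1 := h.norm₂_mul_unitary c (u ^ k)
      rw [hr, h.norm₂_smul] at h1
      exact mul_right_cancel₀ (h.norm₂_pos hc0).ne' (by rw [h1, one_mul])
    rw [mul_assoc y, hr, mul_smul_comm, smul_mul_assoc, map_smul, h.norm₂_smul, hr1, one_mul]
  simp only [hconst] at hlim
  have h0 := h.eq_zero_of_norm₂ (tendsto_nhds_unique tendsto_const_nhds hlim)
  have h1 : star (y * c) = 0 := by
    refine h.faithful _ ?_
    rw [star_star, ← hE.trace_preserving, h0, map_zero]
  have h2 : y * c = 0 := by simpa using congrArg star h1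
  rwa [hy, sub_mul, sub_eq_zero] at h2

/-- Here xc = E(x)c ∈ ℂc for every x. Applying this to x* as well makes c central, hence a nonzero
scalar if c ≠ 0, and then every x is a scalar. -/
theorem IsAsymptoticUnitary.eq_zero_of_minimal (hu : IsAsymptoticUnitary M A E u)
    (hE : IsCondExp M A E) (h : IsNormalizedTrace M (tr M)) (hA : IsAbelian A)
    (hM : IsFactor M) (hinf : ¬ FiniteDimensional ℂ (Elt M)) {c : Elt M}
    (hc : (c : H →L[ℂ] H) ∈ A) (hcs : star c = c)
    (hmin : ∀ d : Elt M, (d : H →L[ℂ] H) ∈ A → ∃ r : ℂ, c * d = r • c) : c = 0 := by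
  by_contra hc0
  have hright : ∀ x : Elt M, ∃ r : ℂ, x * c = r • c := fun x => by
    obtain ⟨r, hr⟩ := hmin _ (hE.map_mem x)
    refine ⟨r, ?_⟩
    rw [hu.mul_eq_of_minimal hE h hc hmin x, ← hr]
    exact Subtype.ext (hA _ (hE.map_mem x) _ hc)
  have hcc : c * c ≠ 0 := fun h0 => hc0 (h.faithful c (by rw [hcs, h0, map_zero]))
  have hcomm : ∀ x : Elt M, x * c = c * x := by
    intro x
    obtain ⟨r, hr⟩ := hright x
    obtain ⟨s, hs⟩ := hright (star x)
    have hs' : c * x = star s • c := by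
      have := congrArg star hs
      rwa [star_mul, star_star, star_smul, hcs] at this
    have : (r - star s) • (c * c) = 0 := by
      rw [sub_smul, ← mul_smul_comm, ← hr, ← smul_mul_assoc, ← hs', mul_assoc, sub_self]
    rcases smul_eq_zero.1 this with h1 | h1
    · rw [hr, hs', sub_eq_zero.1 h1]
    · exact absurd h1 hcc
  obtain ⟨γ, hγ⟩ := hM c c.2 (VonNeumannAlgebra.mem_commutant_iff.2 fun g hg =>
    congrArg Subtype.val (hcomm ⟨g, hg⟩))
  have hγ' : c = γ • (1 : Elt M) := Subtype.ext hγ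
  have hγ0 : γ ≠ 0 := by
    rintro rfl
    exact hc0 (by rw [hγ', zero_smul])
  refine hinf (FiniteDimensional.of_rank_eq_one ?_ : FiniteDimensional ℂ (Elt M))
  refine rank_eq_one_iff.2 ⟨1, ?_, fun x => ?_⟩
  · intro h1
    exact hc0 (by rw [hγ', h1, smul_zero])
  · obtain ⟨r, hr⟩ := hright x
    refine ⟨r, ?_⟩
    rw [hγ', mul_smul_comm, mul_one, smul_comm] at hr
    exact ((smul_right_injective _ hγ0) hr).symm

theorem IsAsymptoticUnitary.exists_orthogonalPartialIsometry (hu : IsAsymptoticUnitary M A E u)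
    (hE : IsCondExp M A E) (hM : IsTypeII₁Factor M) (hAM : A ≤ M) (hA : IsAbelian A) :
    ∃ v, IsOrthogonalPartialIsometry M A v := by
  have h := isNormalizedTrace_tr hM.exists_trace
  obtain ⟨T, hT, -⟩ := h.exists_isTraceOn
  obtain ⟨e, heA, he, hTe⟩ := hT.exists_projection_half hAM hA fun c hc hcs hmin =>
    congrArg Subtype.val (hu.eq_zero_of_minimal hE h hA hM.isFactor hM.infinite_dimensional
      (c := ⟨c, hAM hc⟩) hc (Subtype.ext hcs) fun d hd => by
        obtain ⟨r, hr⟩ := hmin d hd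
        exact ⟨r, Subtype.ext hr⟩)
  have hfA : 1 - e ∈ A := sub_mem (one_mem A) heA
  obtain ⟨v, hvM, hv1, hv2⟩ := hT.exists_partialIsometry hM.isFactor he he.one_sub
    (hAM heA) (hAM hfA) (by rw [map_sub, hT.map_one, hTe]; norm_num)
  have hee : e * e = e := he.isIdempotentElem
  refine ⟨⟨v, hvM⟩, ⟨fun h0 => ?_, ?_, ?_, ?_, ?_⟩⟩
  · have h1 : v = 0 := congrArg Subtype.val h0
    rw [← hv2, h1, mul_zero, map_zero] at hTe
    norm_num at hTe
  · refine Subtype.ext ?_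
    change v * star v * v = v
    -- From v*v = e this yields v = ve, that is, v v* v = v.
    have h1 : star (v - v * e) * (v - v * e) = 0 := by
      rw [star_sub, star_mul, he.isSelfAdjoint.star_eq]
      calc (star v - e * star v) * (v - v * e)
          = star v * v - star v * v * e - e * (star v * v) + e * (star v * v) * e := by
            noncomm_ring
        _ = 0 := by rw [hv2, hee, hee]; abel
    rw [mul_assoc, hv2]
    exact (sub_eq_zero.1 ((CStarRing.star_mul_self_eq_zero_iff _).1 h1)).symm
  · change v * star v ∈ A
    rwa [hv1]
  · change star v * v ∈ A
    rwa [hv2]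
  · refine Subtype.ext ?_
    change v * star v * (star v * v) = 0
    rw [hv1, hv2, sub_mul, one_mul, hee, sub_self]

end Asymptotic

end MasaTheory

theorem theorem6p7 {H : Type*} [NormedAddCommGroup H] [InnerProductSpace ℂ H] [CompleteSpace H]
    (M A : VonNeumannAlgebra H) (hM : MasaTheory.IsTypeII₁Factor M) (hAM : A ≤ M)
    (hA : MasaTheory.IsAbelian A) (hE : MasaTheory.IsAsymptoticHom M A) :
    MasaTheory.IsStronglySingularMasa M A ∧ MasaTheory.HasPopaInvariant M A 1 := by
  obtain ⟨u, huA, hlim⟩ := hE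
  have hu : MasaTheory.IsAsymptoticUnitary M A (MasaTheory.condExp M A) u := ⟨huA, hlim⟩
  have hC := MasaTheory.isCondExp_condExp hM.exists_trace hAM
  exact ⟨hu.isStronglySingularMasa hM.exists_trace hAM hA,
    hu.hasPopaInvariant hM.exists_trace hAM hA
      (hu.exists_orthogonalPartialIsometry hC hM hAM hA)⟩
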